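/- Permutations of $\{1,\dots,N\}$ are written in vector notation $[a_1,\dots,a_N]$. For $2\le i\le N$ the push-to-the-top operation $t_i$ is $t_i[a_1,\dots,a_N]=[a_i,a_1,\dots,a_{i-1},a_{i+1},\dots,a_N]$. Kendall's $\tau$-distance of two permutations is the least number of exchanges of neighbouring entries that transform one into the other. An $(N,M,\mathcal K)$-snake is a cyclic sequence $c_0,\dots,c_{M-1}$ of $M$ distinct permutations of $\{1,\dots,N\}$ in which every $c_{j+1}$ (indices modulo $M$) is $t_i(c_j)$ for some $i\in\{2,\dots,N\}$, and any two of which have Kendall $\tau$-distance at least $2$. Let $n\ge 3$. The class $[x,y]$ consists of the even permutations of $\{1,\dots,2n+1\}$ that end with $x,y$. The necklace $[\alpha]-[x,y]$ is the cyclic sequence of $2n-1$ permutations obtained from $[\alpha,x,y]$ by repeatedly applying $t_{2n-1}$. Define lists of triples $T_5,T_7,\dots$ by $$T_5=\langle1,2,3\rangle,\langle1,2,4\rangle,\langle1,2,5\rangle,\langle1,5,3\rangle,\langle2,3,5\rangle,\langle1,3,4\rangle,\langle2,4,3\rangle,\langle1,4,5\rangle,\langle2,5,4\rangle,$$ where $T_{2m+1}$,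 $m\ge3$, is $T_{2m-1}$ followed by $\langle x,x+1,2m\rangle$ for $2\le x\le 2m-2$, then $\langle x,x+1,2m+1\rangle$ for $2\le x\le 2m-2$, then $\langle1,2,2m\rangle,\langle1,2m,2m-1\rangle,\langle1,2m+1,2m-1\rangle,\langle1,2m,2m+1\rangle,\langle2,2m+1,2m\rangle$. A chain is a cyclic sequence obtained from a necklace in the class $[1,2]$ by processing the triples of $T_{2n+1}$ in order: for $\langle x,y,z\rangle$, named up to cyclic rotation so that the sequence constructed so far contains a permutation $[\beta,z,x,y]$, insert right after it the necklace read from $t_{2n+1}[\beta,z,x,y]=[y,\beta,z,x]$ to $[\beta,y,z,x]$ and then the necklace read from $t_{2n+1}[\beta,y,z,x]=[x,\beta,y,z]$ to $[\beta,x,y,z]$. A linkage is a necklace in the class $[2,1]$. The chain graph $\mathcal G_{2n+1}$ has the chains as vertices; for every linkage $[\alpha,x]-[2,1]$ with $3\le x\le 2n+1$ such that $[\alpha,1,x,2]$ and $[\alpha,2,1,x]$ lie in two distinct chains, these two chains are joined by an edge with label $[\alpha,x]-[2,1]$ (two chains may be joined by several edges). Then for every $n\ge3$ the graph $\mathcal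 G_{2n+1}$ has a spanning tree whose edges have pairwise distinct labels, and there is a $\left(2n+1,\frac{(2n+1)!}{2}-2n+1,\mathcal K\right)$-snake. More precisely, there are such a spanning tree and such a snake for which every transition of the snake is $t_{2n-1}$ or $t_{2n+1}$, and the codewords of the snake are exactly the permutations in the chains together with those in the linkages that label the edges of the tree. (For $n=3$ the size is $2515$.) -/

import Mathlib

/-! Permutations of `{1, …, N}` are elements of `Equiv.Perm (Fin N)`, in vector notation:
the permutation `[a₁, …, a_N]` is the `π` whose value at the (zero-based) position `p` is
the element `a_{p+1}`, an element `a` being represented by `a - 1 : Fin N`. -/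

namespace RankModulation

/-- Push-to-the-top: the element in the (zero-based) position `i` moves to the front and the
elements before it move back by one position. It is the operation `t_{i+1}` for one-based `i+1`:
`[a₁, …, a_i, a_{i+1}, a_{i+2}, …] ↦ [a_{i+1}, a₁, …, a_i, a_{i+2}, …]`. -/
def pushTop {N : ℕ} (i : Fin N) (π : Equiv.Perm (Fin N)) : Equiv.Perm (Fin N) :=
  π * (Fin.cycleRange i)⁻¹

/-- `s` is a transposition of two neighbouring positions; `π * s` is `π` with the elements in
these two positions exchanged. -/
def IsAdjacentSwap {N : ℕ} (s : Equiv.Perm (Fin N)) : Prop :=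
  ∃ i j : Fin N, (j : ℕ) = i + 1 ∧ s = Equiv.swap i j

/-- Kendall's `τ`-distance: the least number of adjacent transpositions that take `σ` to `π`. -/
noncomputable def kendallDist {N : ℕ} (σ π : Equiv.Perm (Fin N)) : ℕ :=
  sInf {k | ∃ l : List (Equiv.Perm (Fin N)),
    l.length = k ∧ (∀ s ∈ l, IsAdjacentSwap s) ∧ σ * l.prod = π}

/-- `c` is an `(N, M, K)`-snake: a cyclic Gray code of `M` distinct permutations
under the push-to-the-top operations `t_2, …, t_N`, any two of whose codewords have Kendall's
`τ`-distance at least two. Here `finRotate M j` is `j + 1` modulo `M`. -/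
structure IsKSnake {N M : ℕ} (c : Fin M → Equiv.Perm (Fin N)) : Prop where
  injective : Function.Injective c
  step : ∀ j : Fin M, ∃ i : Fin N, (i : ℕ) ≠ 0 ∧ c (finRotate M j) = pushTop i (c j)
  dist : ∀ j k : Fin M, j ≠ k → 2 ≤ kendallDist (c j) (c k)

/-- Permutations of `{1, …, 2n+1}`. -/
abbrev OddPerm (n : ℕ) : Type := Equiv.Perm (Fin (2 * n + 1))

/-- The operation `t_{2n-1}` on permutations of `{1, …, 2n+1}`. -/
def tLow {n : ℕ} (π : OddPerm n) : OddPerm n := pushTop ⟨2 * n - 2, by omega⟩ π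

/-- The operation `t_{2n+1}` on permutations of `{1, …, 2n+1}`. -/
def tTop {n : ℕ} (π : OddPerm n) : OddPerm n := pushTop ⟨2 * n, by omega⟩ π

/-- The last three elements `(a_{2n-1}, a_{2n}, a_{2n+1})`, as elements of `{1, …, 2n+1}`. -/
def lastThree {n : ℕ} (π : OddPerm n) : ℕ × ℕ × ℕ :=
  ((π ⟨2 * n - 2, by omega⟩ : ℕ) + 1, (π ⟨2 * n - 1, by omega⟩ : ℕ) + 1,
    (π ⟨2 * n, by omega⟩ : ℕ) + 1)

/-- The necklace of `π`, read from `π`: the `2n-1` permutations obtained from `π` by repeating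
`t_{2n-1}`. -/
def necklaceList {n : ℕ} (π : OddPerm n) : List (OddPerm n) :=
  (List.range (2 * n - 1)).map fun k => tLow^[k] π

/-- The necklace `[α]-[x,y]` of `π = [α, x, y]`, as a cyclic sequence. -/
def necklace {n : ℕ} (π : OddPerm n) : Cycle (OddPerm n) :=
  (necklaceList π : Cycle (OddPerm n))

/-- The edges `⟨x, y, z⟩` of the nearly spanning tree `T_{2n+1}` for `n ≥ 2`, in the order in which
they are processed. (`n = 0, 1` are dummy values.) -/
def nearlySpanningTree : ℕ → List (ℕ × ℕ × ℕ)
  | 0 => []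
  | 1 => []
  | 2 => [(1, 2, 3), (1, 2, 4), (1, 2, 5), (1, 5, 3), (2, 3, 5), (1, 3, 4), (2, 4, 3), (1, 4, 5),
      (2, 5, 4)]
  | m + 3 =>
    let n := m + 3
    nearlySpanningTree (m + 2)
      ++ (List.range' 2 (2 * n - 3)).map (fun x => (x, x + 1, 2 * n))
      ++ (List.range' 2 (2 * n - 3)).map (fun x => (x, x + 1, 2 * n + 1))
      ++ [(1, 2, 2 * n), (1, 2 * n, 2 * n - 1), (1, 2 * n + 1, 2 * n - 1), (1, 2 * n, 2 * n + 1),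
        (2, 2 * n + 1, 2 * n)]

/-- One merging step along the edge `⟨x, y, z⟩`: right after a permutation `p = [β, z, x, y]` of the
sequence (up to cyclic renaming of the edge), insert the necklace that starts from
`t_{2n+1} p = [y, β, z, x]` and ends with `[β, y, z, x]`, and then the necklace that starts from
`t_{2n+1} [β, y, z, x] = [x, β, y, z]` and ends with `[β, x, y, z]`. -/
def mergeEdge {n : ℕ} (L : List (OddPerm n)) (e : ℕ × ℕ × ℕ) : List (OddPerm n) :=
  L.flatMap fun p =>
    if lastThree p = (e.2.2, e.1, e.2.1) ∨ lastThree p = (e.1, e.2.1, e.2.2) ∨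
        lastThree p = (e.2.1, e.2.2, e.1) then
      p :: (necklaceList (tTop p) ++ necklaceList (tTop (tLow^[2 * n - 2] (tTop p))))
    else [p]

/-- The chain grown from the necklace of `π` by processing the edges of `T_{2n+1}` one after
the other, as a cyclic sequence. -/
def chainOf {n : ℕ} (π : OddPerm n) : Cycle (OddPerm n) :=
  (((nearlySpanningTree n).foldl mergeEdge (necklaceList π) : List (OddPerm n)) : Cycle (OddPerm n))

/-- `π` is an even permutation in the class `[x,y]`, i.e. it ends with `x, y`. -/
def InClass {n : ℕ} (π : OddPerm n) (x y : ℕ) : Prop :=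
  Equiv.Perm.sign π = 1 ∧ (lastThree π).2 = (x, y)

/-- The chains: those grown from the necklaces in the class `[1,2]`. -/
def Chain (n : ℕ) : Type :=
  {c : Cycle (OddPerm n) // ∃ π : OddPerm n, InClass π 1 2 ∧ c = chainOf π}

/-- The linkages: the necklaces in the class `[2,1]`. -/
def Linkage (n : ℕ) : Type :=
  {l : Cycle (OddPerm n) // ∃ π : OddPerm n, InClass π 2 1 ∧ l = necklace π}

/-- The `M[x]`-connection via the linkage `l = [α,x]-[2,1]` joins `c` and `d`, where the distinct
chains `c` and `d` contain `ρ = [α,1,x,2]` and `σ = [α,2,1,x]` respectively. -/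
def Connects {n : ℕ} (x : ℕ) (l : Linkage n) (c d : Chain n) : Prop :=
  3 ≤ x ∧ x ≤ 2 * n + 1 ∧ c ≠ d ∧ ∃ π ρ σ : OddPerm n,
    (∀ p : Fin (2 * n + 1), (p : ℕ) < 2 * n - 2 → ρ p = π p ∧ σ p = π p) ∧
    lastThree π = (x, 2, 1) ∧ lastThree ρ = (1, x, 2) ∧ lastThree σ = (2, 1, x) ∧
    l.1 = necklace π ∧ ρ ∈ c.1 ∧ σ ∈ d.1

/-- The chain graph `G_{2n+1}` has an edge between `c` and `d` with sign `M[x]` and label `l`.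
(There may be several edges between two chains, with different signs or labels.) -/
def IsEdge {n : ℕ} (x : ℕ) (l : Linkage n) (c d : Chain n) : Prop :=
  Connects x l c d ∨ Connects x l d c

/-- `T` is a spanning tree of the chain graph `G_{2n+1}` in which every edge is taken with one of its
labels, chosen by `label`, and the chosen labels are pairwise distinct. -/
structure IsDistinctlyLabelledSpanningTree {n : ℕ} (T : SimpleGraph (Chain n))
    (label : T.edgeSet → Linkage n) : Prop where
  isTree : T.IsTree
  isEdge : ∀ (c d : Chain n) (h : T.Adj c d), ∃ x : ℕ, IsEdge x (label ⟨s(c, d), h⟩) c d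
  distinct : Function.Injective label

end RankModulation

/-! Write $r$ for the rotation `lastRot` of the last three entries,
$[\beta,z,x,y]\mapsto[\beta,y,z,x]$. The identity behind everything is $t_{2n+1}(p)=t_{2n-1}(pr)$
(`tTop_eq`). If $t_{2n-1}$ is replaced by $t_{2n+1}$ on a triple $p,pr,pr^2$ whose members lie in
three different cycles, these cycles become one (`sameCycle_merge`). Start with the necklaces as
cycles. Merge along $T_{2n+1}$ to get the chains, then along a tree of chains, with one linkage for
each edge.

Chains. The triples of $T_{2n+1}$ grow a hypertree on the classes: each joins one visited class to
two new ones, and only $[2,1]$ is never visited (`grow_nearlySpanningTree`). Since $pr=\gamma p$,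
where $\gamma$ is a 3-cycle of labels, one can choose for each class an even relabelling `Φ` to
$[1,2]$ such that `root Φ p` does not change along a merging step (`Grow.exists_relabelling`). A
chain is then the set of all `p` in visited classes with `root Φ p` on a fixed necklace
(`mem_chainOf`).

Tree. Move the label 4 to position $2n-1$. Chains become the odd permutations of the labels other
than 1, 2, 4, and linkages the even ones. The linkage $u$, used with $x\ge6$, joins $(3\;x)u$ to
$b_xu$. If $x\in\{2j,2j+1\}$, then $b_x$ is odd, sends $2j-1$ to $x$, and fixes 1, 2, 4 and every
label from $2j$ on other than $x$. An induction that adds two labels at a time chooses one $x$ for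
each $u\ne1$ so that all chains are connected (`Connectable.add_two`). There is exactly one chain
more than there are such $u$, so the chosen edges form a tree, with distinct labels by construction
(`exists_spanningTree`).

Snake. Each edge of this tree merges its two chains with its linkage, because the edge is a bridge
(`LinksTree.exists_isMerged_insert`). The result is one cycle through all even permutations except
the $2n-1$ on the linkage of $u=1$. All codewords are even, so no two differ by one exchange of
neighbours (`two_le_kendallDist`). -/

namespace RankModulation

open Equiv

/-! ### Positions, necklaces, and the relation between the two operations. -/

/-- The first of the last three positions. -/
def posA (n : ℕ) : Fin (2 * n + 1) := ⟨2 * n - 2, by omega⟩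

/-- The second of the last three positions. -/
def posB (n : ℕ) : Fin (2 * n + 1) := ⟨2 * n - 1, by omega⟩

/-- The last position. -/
def posC (n : ℕ) : Fin (2 * n + 1) := ⟨2 * n, by omega⟩

/-- The cyclic permutation of the first `2n-1` positions. -/
def lowCycle (n : ℕ) : OddPerm n := Fin.cycleRange (posA n)

/-- The cycle `a → b → c → a`. -/
def cyc {α : Type*} [DecidableEq α] (a b c : α) : Perm α := swap a b * swap b c

/-- The cyclic permutation of the last three positions,
right multiplication by which is `[β, z, x, y] ↦ [β, y, z, x]`. -/
def lastRot (n : ℕ) : OddPerm n := cyc (posA n) (posC n) (posB n)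

section cyc

variable {α : Type*} [DecidableEq α]

theorem cyc_apply_left {a b c : α} (hab : a ≠ b) (hac : a ≠ c) : cyc a b c a = b := by
  simp [cyc, swap_apply_of_ne_of_ne hab hac]

theorem cyc_apply_mid {a b c : α} (hac : a ≠ c) (hbc : b ≠ c) : cyc a b c b = c := by
  simp [cyc, swap_apply_of_ne_of_ne hac.symm hbc.symm]

theorem cyc_apply_right (a b c : α) : cyc a b c c = a := by simp [cyc]

theorem cyc_apply_of_ne {a b c d : α} (ha : d ≠ a) (hb : d ≠ b) (hc : d ≠ c) :
    cyc a b c d = d := by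
  simp [cyc, swap_apply_of_ne_of_ne, *]

/-- Conjugation by `p` turns a cycle of positions into a cycle of labels. -/
theorem mul_cyc (p : Perm α) (a b c : α) : p * cyc a b c = cyc (p a) (p b) (p c) * p := by
  have h (u v : α) : p * swap u v = swap (p u) (p v) * p := Equiv.mul_swap_eq_swap_mul p u v
  rw [cyc, cyc, ← mul_assoc, h, mul_assoc, h, mul_assoc]

theorem cyc_rotate {a b c : α} (hab : a ≠ b) (hac : a ≠ c) (hbc : b ≠ c) :
    cyc b c a = cyc a b c := by
  ext d
  by_cases ha : d = a
  · subst ha; rw [cyc_apply_right, cyc_apply_left hab hac]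
  by_cases hb : d = b
  · subst hb; rw [cyc_apply_left hbc hab.symm, cyc_apply_mid hac hbc]
  by_cases hc : d = c
  · subst hc; rw [cyc_apply_right, cyc_apply_mid hab.symm hac.symm]
  rw [cyc_apply_of_ne ha hb hc, cyc_apply_of_ne hb hc ha]

theorem cyc_pow_three {a b c : α} (hab : a ≠ b) (hac : a ≠ c) (hbc : b ≠ c) :
    cyc a b c * cyc a b c * cyc a b c = 1 := by
  ext d
  simp only [Perm.mul_apply, Perm.one_apply]
  by_cases ha : d = a
  · subst ha; rw [cyc_apply_left hab hac, cyc_apply_mid hac hbc, cyc_apply_right]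
  by_cases hb : d = b
  · subst hb; rw [cyc_apply_mid hac hbc, cyc_apply_right, cyc_apply_left hab hac]
  by_cases hc : d = c
  · subst hc; rw [cyc_apply_right, cyc_apply_left hab hac, cyc_apply_mid hac hbc]
  simp only [cyc_apply_of_ne ha hb hc]

theorem sign_cyc [Fintype α] {a b c : α} (hab : a ≠ b) (hbc : b ≠ c) :
    Perm.sign (cyc a b c) = 1 := by
  simp [cyc, Perm.sign_swap hab, Perm.sign_swap hbc]

end cyc

variable {n : ℕ}

theorem posA_ne_posB (hn : 3 ≤ n) : posA n ≠ posB n := by simp [posA, posB]; omega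
theorem posA_ne_posC (hn : 3 ≤ n) : posA n ≠ posC n := by simp [posA, posC]; omega
theorem posB_ne_posC (hn : 3 ≤ n) : posB n ≠ posC n := by simp [posC, posB]; omega

theorem tLow_eq (p : OddPerm n) : tLow p = p * (lowCycle n)⁻¹ := rfl

theorem lastRot_pow_three (hn : 3 ≤ n) : lastRot n * lastRot n * lastRot n = 1 :=
  cyc_pow_three (posA_ne_posC hn) (posA_ne_posB hn) (posB_ne_posC hn).symm

theorem mul_lastRot_three (hn : 3 ≤ n) (p : OddPerm n) :
    p * lastRot n * lastRot n * lastRot n = p := by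
  rw [mul_assoc, mul_assoc, ← mul_assoc (lastRot n), lastRot_pow_three hn, mul_one]

theorem sign_lastRot (hn : 3 ≤ n) : Perm.sign (lastRot n) = 1 :=
  sign_cyc (posA_ne_posC hn) (posB_ne_posC hn).symm

theorem cycleRange_mul_lastRot (hn : 3 ≤ n) :
    Fin.cycleRange (posC n) * lastRot n = lowCycle n := by
  have hAB := posA_ne_posB hn
  have hAC := posA_ne_posC hn
  have hBC := posB_ne_posC hn
  ext i
  rw [Perm.mul_apply]
  rcases lt_trichotomy i.val (2 * n - 2) with h | h | h
  · have h1 : i ≠ posA n := by intro e; simp [e, posA] at h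
    have h2 : i ≠ posB n := by intro e; simp [e, posB] at h; omega
    have h3 : i ≠ posC n := by intro e; simp [e, posC] at h; omega
    rw [lastRot, cyc_apply_of_ne h1 h3 h2, lowCycle, Fin.coe_cycleRange_of_lt,
      Fin.coe_cycleRange_of_lt]
    · exact h
    · rw [Fin.lt_def]; simp only [posC]; omega
  · have h1 : i = posA n := Fin.ext h
    rw [h1, lastRot, cyc_apply_left hAC hAB, lowCycle, Fin.cycleRange_self, Fin.cycleRange_self]
  · have hA : (posA n).val = 2 * n - 2 := rfl
    have hB : (posB n).val = 2 * n - 1 := rfl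
    have hC : (posC n).val = 2 * n := rfl
    obtain h1 | h1 : i = posB n ∨ i = posC n := by
      have := i.isLt
      simp only [Fin.ext_iff]; omega
    · have h2 : lowCycle n (posB n) = posB n :=
        Fin.cycleRange_of_gt (by rw [Fin.lt_def]; omega)
      have h3 : ((posC n).cycleRange (posA n)).val = (posA n).val + 1 :=
        Fin.coe_cycleRange_of_lt (by rw [Fin.lt_def]; omega)
      rw [h1, lastRot, cyc_apply_right, h2, h3]
      omega
    · have h2 : lowCycle n (posC n) = posC n :=
        Fin.cycleRange_of_gt (by rw [Fin.lt_def]; omega)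
      have h3 : ((posC n).cycleRange (posB n)).val = (posB n).val + 1 :=
        Fin.coe_cycleRange_of_lt (by rw [Fin.lt_def]; omega)
      rw [h1, lastRot, cyc_apply_mid hAB hBC.symm, h2, h3]
      omega

/-- Up to a step along a necklace, $t_{2n+1}$ is just the rotation of the last three entries: it
leads from the necklace of `p` to that of `p * lastRot n`. -/
theorem tTop_eq (hn : 3 ≤ n) (p : OddPerm n) : tTop p = tLow (p * lastRot n) := by
  have h : (Fin.cycleRange (posC n))⁻¹ = lastRot n * (lowCycle n)⁻¹ := by
    rw [← cycleRange_mul_lastRot hn]; simp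
  rw [tLow_eq, mul_assoc, ← h]; rfl

theorem posA_val_ne_zero (hn : 3 ≤ n) : posA n ≠ 0 := by
  simp only [posA, ne_eq, Fin.ext_iff, Fin.val_zero]; omega

theorem isCycle_lowCycle (hn : 3 ≤ n) : (lowCycle n).IsCycle :=
  Fin.isCycle_cycleRange (posA_val_ne_zero hn)

theorem sign_lowCycle : Perm.sign (lowCycle n) = 1 := by
  rw [lowCycle, Fin.sign_cycleRange]
  exact Even.neg_one_pow ⟨n - 1, by simp only [posA]; omega⟩

theorem orderOf_lowCycle (hn : 3 ≤ n) : orderOf (lowCycle n) = 2 * n - 1 := by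
  rw [(isCycle_lowCycle hn).orderOf, ← Multiset.sum_singleton (Finset.card _),
    ← (isCycle_lowCycle hn).cycleType, lowCycle,
    Fin.cycleType_cycleRange (posA_val_ne_zero hn)]
  simp only [Multiset.sum_singleton, posA]; omega

theorem lowCycle_pow (hn : 3 ≤ n) : lowCycle n ^ (2 * n - 1) = 1 := by
  rw [← orderOf_lowCycle hn, pow_orderOf_eq_one]

theorem lowCycle_posB (hn : 3 ≤ n) : lowCycle n (posB n) = posB n :=
  Fin.cycleRange_of_gt (by rw [Fin.lt_def]; simp only [posA, posB]; omega)

theorem lowCycle_posC (hn : 3 ≤ n) : lowCycle n (posC n) = posC n :=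
  Fin.cycleRange_of_gt (by rw [Fin.lt_def]; simp only [posA, posC]; omega)

theorem lowCycle_apply_ne (hn : 3 ≤ n) {i : Fin (2 * n + 1)} (hB : i ≠ posB n) (hC : i ≠ posC n) :
    lowCycle n i ≠ i := by
  have := i.isLt
  simp only [posB, posC, ne_eq, Fin.ext_iff] at hB hC
  rcases lt_or_eq_of_le (show i.val ≤ 2 * n - 2 by omega) with h | h
  · rw [ne_eq, Fin.ext_iff, lowCycle, Fin.coe_cycleRange_of_lt]
    · omega
    · exact h
  · have h1 : i = posA n := Fin.ext h
    rw [h1, lowCycle, Fin.cycleRange_self]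
    exact (posA_val_ne_zero hn).symm

/-- `q` lies on the necklace of `p`. -/
def Neck (p q : OddPerm n) : Prop := ∃ k : ℤ, q = p * lowCycle n ^ k

theorem Neck.refl (p : OddPerm n) : Neck p p := ⟨0, by simp⟩

theorem Neck.symm {p q : OddPerm n} : Neck p q → Neck q p := by
  rintro ⟨k, rfl⟩; exact ⟨-k, by simp⟩

theorem Neck.trans {p q t : OddPerm n} : Neck p q → Neck q t → Neck p t := by
  rintro ⟨k, rfl⟩ ⟨l, rfl⟩; exact ⟨k + l, by rw [zpow_add, mul_assoc]⟩

theorem Neck.mul_left {p q : OddPerm n} (g : OddPerm n) : Neck p q → Neck (g * p) (g * q) := by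
  rintro ⟨k, rfl⟩; exact ⟨k, by rw [mul_assoc]⟩

theorem neck_tLow (p : OddPerm n) : Neck p (tLow p) := ⟨-1, by rw [tLow_eq, zpow_neg_one]⟩

theorem Neck.sign {p q : OddPerm n} : Neck p q → Perm.sign q = Perm.sign p := by
  rintro ⟨k, rfl⟩; simp [sign_lowCycle]

theorem Neck.apply_posB (hn : 3 ≤ n) {p q : OddPerm n} : Neck p q → q (posB n) = p (posB n) := by
  rintro ⟨k, rfl⟩
  rw [Perm.mul_apply, Perm.zpow_apply_eq_self_of_apply_eq_self (lowCycle_posB hn)]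

theorem Neck.apply_posC (hn : 3 ≤ n) {p q : OddPerm n} : Neck p q → q (posC n) = p (posC n) := by
  rintro ⟨k, rfl⟩
  rw [Perm.mul_apply, Perm.zpow_apply_eq_self_of_apply_eq_self (lowCycle_posC hn)]

/-- `lowCycle` is a single cycle on all positions but the last two, so a power of it that fixes
`posA` is trivial. With `exists_neck_apply_posA`, a necklace has exactly one member for each
admissible entry at `posA`. -/
theorem Neck.eq_of_apply_posA (hn : 3 ≤ n) {p q : OddPerm n} (h : Neck p q)
    (hA : q (posA n) = p (posA n)) : q = p := by
  obtain ⟨k, rfl⟩ := h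
  rw [Perm.mul_apply, p.injective.eq_iff] at hA
  have h1 : (lowCycle n ^ k : OddPerm n) = 1 := by
    ext y
    by_cases hy : lowCycle n y = y
    · rw [Perm.zpow_apply_eq_self_of_apply_eq_self hy, Perm.one_apply]
    · obtain ⟨m, rfl⟩ := (isCycle_lowCycle hn).sameCycle
        (lowCycle_apply_ne hn (posA_ne_posB hn) (posA_ne_posC hn)) hy
      rw [← Perm.mul_apply, ← zpow_add, add_comm k m, zpow_add, Perm.mul_apply, hA, Perm.one_apply]
  rw [h1, mul_one]

theorem exists_neck_apply_posA (hn : 3 ≤ n) (p : OddPerm n) {a : Fin (2 * n + 1)}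
    (hB : a ≠ p (posB n)) (hC : a ≠ p (posC n)) : ∃ q, Neck p q ∧ q (posA n) = a := by
  obtain ⟨k, hk⟩ := (isCycle_lowCycle hn).sameCycle
    (lowCycle_apply_ne hn (posA_ne_posB hn) (posA_ne_posC hn))
    (lowCycle_apply_ne hn (i := p⁻¹ a) (by rintro e; apply hB; rw [← e]; simp)
      (by rintro e; apply hC; rw [← e]; simp))
  exact ⟨_, ⟨k, rfl⟩, by rw [Perm.mul_apply, hk]; simp⟩

theorem tLow_iterate (k : ℕ) (p : OddPerm n) : tLow^[k] p = p * (lowCycle n)⁻¹ ^ k := by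
  induction k with
  | zero => simp
  | succ k ih => rw [Function.iterate_succ_apply', ih, tLow_eq, pow_succ, mul_assoc]

theorem tLow_iterate_period (hn : 3 ≤ n) (p : OddPerm n) : tLow^[2 * n - 1] p = p := by
  rw [tLow_iterate, inv_pow, lowCycle_pow hn]; simp

theorem mem_necklaceList (hn : 3 ≤ n) {p q : OddPerm n} : q ∈ necklaceList p ↔ Neck p q := by
  simp only [necklaceList, List.mem_map, List.mem_range, tLow_iterate]
  constructor
  · rintro ⟨k, -, rfl⟩
    exact ⟨-k, by simp⟩
  · rintro ⟨k, rfl⟩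
    have hm : (0 : ℤ) < (2 * n - 1 : ℕ) := by omega
    have h0 := Int.emod_nonneg (-k) hm.ne'
    have h1 := Int.emod_lt_of_pos (-k) hm
    refine ⟨((-k) % (2 * n - 1 : ℕ)).toNat, by omega, ?_⟩
    congr 1
    rw [← zpow_natCast, Int.toNat_of_nonneg h0, inv_zpow', ← orderOf_lowCycle hn]
    have h2 := zpow_mod_orderOf (lowCycle n)⁻¹ (-k)
    rw [orderOf_inv] at h2
    rw [zpow_neg, ← inv_zpow, h2, inv_zpow', neg_neg]

theorem necklaceList_tLow (hn : 3 ≤ n) (p : OddPerm n) :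
    necklaceList p ~r necklaceList (tLow p) := by
  refine ⟨1, ?_⟩
  obtain ⟨m, hm⟩ : ∃ m, 2 * n - 1 = m + 1 := ⟨2 * n - 2, by omega⟩
  have hp : tLow^[m + 1] p = p := hm ▸ tLow_iterate_period hn p
  unfold necklaceList
  rw [hm, List.range_succ_eq_map]
  conv_rhs => rw [← List.range_succ_eq_map, List.range_succ]
  simp only [List.map_cons, List.map_map, List.rotate_cons_succ, List.rotate_zero, List.map_append,
    List.map_nil]
  congr 1
  rw [← Function.iterate_succ_apply, hp]; rfl

/-- The label `l`, as an element of `Fin (2n+1)`. -/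
def lab (n l : ℕ) : Fin (2 * n + 1) := ⟨(l - 1) % (2 * n + 1), Nat.mod_lt _ (by omega)⟩

theorem lab_val_add_one (i : Fin (2 * n + 1)) : lab n (i.val + 1) = i := by
  have := i.isLt
  simp [lab, Nat.mod_eq_of_lt this]

theorem val_lab {l : ℕ} (h1 : 1 ≤ l) (h2 : l ≤ 2 * n + 1) : (lab n l).val + 1 = l := by
  simp only [lab]; rw [Nat.mod_eq_of_lt (by omega)]; omega

theorem lab_ne {k l : ℕ} (h : k ≠ l) (hk : 1 ≤ k) (hk' : k ≤ 2 * n + 1) (hl : 1 ≤ l)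
    (hl' : l ≤ 2 * n + 1) : lab n k ≠ lab n l := by
  intro e
  exact h (by rw [← val_lab hk hk', e, val_lab hl hl'])

theorem lastThree_eq_iff {p : OddPerm n} {x y z : ℕ} : lastThree p = (x, y, z) ↔
    (p (posA n)).val + 1 = x ∧ (p (posB n)).val + 1 = y ∧ (p (posC n)).val + 1 = z := by
  simp [lastThree, posA, posB, posC]

theorem lastThree_eq (p : OddPerm n) : lastThree p =
    ((p (posA n)).val + 1, (p (posB n)).val + 1, (p (posC n)).val + 1) := rfl

theorem lastThree_mul_lastRot (hn : 3 ≤ n) {p : OddPerm n} {x y z : ℕ}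
    (h : lastThree p = (x, y, z)) : lastThree (p * lastRot n) = (z, x, y) := by
  rw [lastThree_eq_iff] at h ⊢
  obtain ⟨rfl, rfl, rfl⟩ := h
  have hAB := posA_ne_posB hn
  have hAC := posA_ne_posC hn
  have hBC := posB_ne_posC hn
  simp only [Perm.mul_apply, lastRot]
  rw [cyc_apply_left hAC hAB, cyc_apply_right, cyc_apply_mid hAB hBC.symm]
  simp

/-- As a left multiplication the rotation depends only on the last three labels and not on the rest
of `p`. This allows one relabelling per class. -/
theorem mul_lastRot_of_lastThree {p : OddPerm n} {x y z : ℕ} (h : lastThree p = (x, y, z)) :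
    p * lastRot n = cyc (lab n x) (lab n z) (lab n y) * p := by
  rw [lastThree_eq_iff] at h
  obtain ⟨rfl, rfl, rfl⟩ := h
  rw [lastRot, mul_cyc]
  simp only [lab_val_add_one]

theorem Neck.lastThree_snd (hn : 3 ≤ n) {p q : OddPerm n} (h : Neck p q) :
    (lastThree q).2 = (lastThree p).2 := by
  simp only [lastThree_eq, h.apply_posB hn, h.apply_posC hn]

theorem Neck.eq_of_lastThree (hn : 3 ≤ n) {p q : OddPerm n} (h : Neck p q)
    (hA : lastThree q = lastThree p) : q = p := by
  refine h.eq_of_apply_posA hn (Fin.ext ?_)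
  have := congrArg Prod.fst hA
  simpa [lastThree_eq] using this

theorem exists_neck_lastThree (hn : 3 ≤ n) (p : OddPerm n) {x y z : ℕ}
    (h : (lastThree p).2 = (y, z)) (hx : 1 ≤ x) (hx' : x ≤ 2 * n + 1) (hxy : x ≠ y) (hxz : x ≠ z) :
    ∃ q, Neck p q ∧ lastThree q = (x, y, z) := by
  simp only [lastThree_eq, Prod.mk.injEq] at h
  obtain ⟨q, hq, hA⟩ := exists_neck_apply_posA hn p (a := lab n x)
    (by intro e; apply hxy; rw [← h.1, ← e, val_lab hx hx'])
    (by intro e; apply hxz; rw [← h.2, ← e, val_lab hx hx'])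
  refine ⟨q, hq, ?_⟩
  rw [lastThree_eq_iff, hA, hq.apply_posB hn, hq.apply_posC hn, val_lab hx hx']
  exact ⟨rfl, h⟩

end RankModulation

namespace RankModulation

open Equiv

/-! ### The nearly spanning tree as a hypertree on the classes. -/

/-- `t` is the triple `e` up to cyclic rotation. -/
def Matches (e t : ℕ × ℕ × ℕ) : Prop :=
  t = (e.2.2, e.1, e.2.1) ∨ t = (e.1, e.2.1, e.2.2) ∨ t = (e.2.1, e.2.2, e.1)

theorem Matches.rotate {e : ℕ × ℕ × ℕ} {x y z : ℕ} (h : Matches e (x, y, z)) :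
    Matches e (y, z, x) := by
  simp only [Matches, Prod.mk.injEq] at h ⊢
  tauto

theorem Matches.eq_or {e : ℕ × ℕ × ℕ} {x y z x' y' z' : ℕ} (h : Matches e (x, y, z))
    (h' : Matches e (x', y', z')) :
    (x' = x ∧ y' = y ∧ z' = z) ∨ (x' = y ∧ y' = z ∧ z' = x) ∨ (x' = z ∧ y' = x ∧ z' = y) := by
  simp only [Matches, Prod.mk.injEq] at h h'
  omega

/-- Starting with the classes in `V`, each edge of the list joins one class that was visited
before to two new ones; the classes in `W` are those visited at the end. -/
inductive Grow (N : ℕ) : Set (ℕ × ℕ) → List (ℕ × ℕ × ℕ) → Set (ℕ × ℕ) → Prop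
  | nil (V : Set (ℕ × ℕ)) : Grow N V [] V
  | cons {V W : Set (ℕ × ℕ)} {e : ℕ × ℕ × ℕ} {E : List (ℕ × ℕ × ℕ)} (x y z : ℕ)
      (he : Matches e (x, y, z)) (hV : (x, y) ∈ V) (hyz : (y, z) ∉ V) (hzx : (z, x) ∉ V)
      (hne : x ≠ y ∧ y ≠ z ∧ x ≠ z) (hlow : 1 ≤ x ∧ 1 ≤ y ∧ 1 ≤ z) (hup : x ≤ N ∧ y ≤ N ∧ z ≤ N)
      (h : Grow N (V ∪ {(y, z), (z, x)}) E W) : Grow N V (e :: E) W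

theorem Grow.nil_of_eq {N : ℕ} {V W : Set (ℕ × ℕ)} (h : V = W) : Grow N V [] W := h ▸ Grow.nil V

theorem Grow.append {N : ℕ} {V W X : Set (ℕ × ℕ)} {E F : List (ℕ × ℕ × ℕ)} (h : Grow N V E W)
    (h' : Grow N W F X) : Grow N V (E ++ F) X := by
  induction h with
  | nil V => exact h'
  | cons x y z he hV hyz hzx hne hlow hup _ ih =>
    exact Grow.cons x y z he hV hyz hzx hne hlow hup (ih h')

/-- The classes visited by a chain: all but `[2,1]`. -/
def visited (n : ℕ) : Set (ℕ × ℕ) :=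
  {q | 1 ≤ q.1 ∧ q.1 ≤ 2 * n + 1 ∧ 1 ≤ q.2 ∧ q.2 ≤ 2 * n + 1 ∧ q.1 ≠ q.2 ∧ ¬ (q.1 = 2 ∧ q.2 = 1)}

/-- The triple $\langle x,x+1,z\rangle$ is entered from $[x,x+1]$ and adds $[x+1,z]$ and $[z,x]$.
Different $x$ add different classes, so the run can be processed in any state where these are
unvisited. -/
theorem Grow.range' {N z : ℕ} (hz : z ≤ N) (k : ℕ) : ∀ (a : ℕ) (V : Set (ℕ × ℕ)), 1 ≤ a →
    a + k < z → (∀ x, a ≤ x → x < a + k → (x, x + 1) ∈ V ∧ (x + 1, z) ∉ V ∧ (z, x) ∉ V) →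
    Grow N V ((List.range' a k).map fun x => (x, x + 1, z))
      (V ∪ {q | (q.2 = z ∧ a + 1 ≤ q.1 ∧ q.1 < a + k + 1) ∨ (q.1 = z ∧ a ≤ q.2 ∧ q.2 < a + k)}) := by
  induction k with
  | zero =>
    intro a V _ _ _
    refine Grow.nil_of_eq ?_
    ext ⟨p, q⟩
    simp only [Set.mem_union, Set.mem_ofPred_eq]
    exact ⟨Or.inl, fun h => h.resolve_right (by omega)⟩
  | succ k ih =>
    intro a V ha hk h
    rw [List.range'_succ, List.map_cons]
    obtain ⟨h1, h2, h3⟩ := h a le_rfl (by omega)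
    refine Grow.cons a (a + 1) z (Or.inr (Or.inl rfl)) h1 h2 h3 ⟨by omega, by omega, by omega⟩
      ⟨by omega, by omega, by omega⟩ ⟨by omega, by omega, by omega⟩ ?_
    have key := ih (a + 1) (V ∪ {(a + 1, z), (z, a)}) (by omega) (by omega) (by
      intro x hx hx'
      obtain ⟨h4, h5, h6⟩ := h x (by omega) (by omega)
      refine ⟨Or.inl h4, ?_, ?_⟩
      · simp only [Set.mem_union, h5, Set.mem_insert_iff, Set.mem_singleton_iff, Prod.mk.injEq,
          and_true, false_or]
        omega
      · simp only [Set.mem_union, h6, Set.mem_insert_iff, Set.mem_singleton_iff, Prod.mk.injEq,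
          true_and, false_or]
        omega)
    convert key using 1
    ext ⟨p, q⟩
    simp only [Set.mem_union, Set.mem_insert_iff, Set.mem_singleton_iff, Set.mem_ofPred_eq,
      Prod.mk.injEq, or_assoc]
    refine or_congr_right ?_
    omega

theorem grow_nearlySpanningTree_two {N : ℕ} (hN : 5 ≤ N) :
    Grow N {(1, 2)} (nearlySpanningTree 2) (visited 2) := by
  refine Grow.cons 1 2 3 (by simp [Matches]) (by simp) (by simp) (by simp) (by omega) (by omega)
    (by omega) ?_
  refine Grow.cons 1 2 4 (by simp [Matches]) (by simp) (by simp) (by simp) (by omega) (by omega)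
    (by omega) ?_
  refine Grow.cons 1 2 5 (by simp [Matches]) (by simp) (by simp) (by simp) (by omega) (by omega)
    (by omega) ?_
  -- Triples are rotated so that their first two entries name the class already visited; here
  -- $[3,1]$ comes from $\langle1,2,3\rangle$.
  refine Grow.cons 3 1 5 (by simp [Matches]) (by simp) (by simp) (by simp) (by omega) (by omega)
    (by omega) ?_
  refine Grow.cons 2 3 5 (by simp [Matches]) (by simp) (by simp) (by simp) (by omega) (by omega)
    (by omega) ?_
  refine Grow.cons 4 1 3 (by simp [Matches]) (by simp) (by simp) (by simp) (by omega) (by omega)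
    (by omega) ?_
  refine Grow.cons 2 4 3 (by simp [Matches]) (by simp) (by simp) (by simp) (by omega) (by omega)
    (by omega) ?_
  refine Grow.cons 5 1 4 (by simp [Matches]) (by simp) (by simp) (by simp) (by omega) (by omega)
    (by omega) ?_
  refine Grow.cons 2 5 4 (by simp [Matches]) (by simp) (by simp) (by simp) (by omega) (by omega)
    (by omega) ?_
  refine Grow.nil_of_eq ?_
  ext ⟨p, q⟩
  simp only [visited, Set.mem_union, Set.mem_insert_iff, Set.mem_singleton_iff, Prod.mk.injEq,
    Set.mem_ofPred_eq]
  have hp (h : ¬ (p < 6 ∧ q < 6)) : ¬ (1 ≤ p ∧ p ≤ 2 * 2 + 1 ∧ 1 ≤ q ∧ q ≤ 2 * 2 + 1 ∧ p ≠ q ∧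
      ¬ (p = 2 ∧ q = 1)) := by omega
  by_cases h : p < 6 ∧ q < 6
  · obtain ⟨h1, h2⟩ := h
    clear hp
    interval_cases p <;> interval_cases q <;> simp
  · refine iff_of_false ?_ (hp h)
    omega

/-- After the two runs ten classes other than $[2,1]$ are missing: $[1,w],[2,w],[w,1],[w,k-1]$ for
$w=k,k+1$, and $[k,k+1],[k+1,k]$. The five last triples add two each. -/
theorem grow_last_edges {N k : ℕ} (hk : 6 ≤ k) (hN : k + 1 ≤ N) {V : Set (ℕ × ℕ)}
    (hV : ∀ p q, (p, q) ∈ V ↔ (1 ≤ p ∧ p < k ∧ 1 ≤ q ∧ q < k ∧ p ≠ q ∧ ¬ (p = 2 ∧ q = 1)) ∨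
      ((q = k ∨ q = k + 1) ∧ 3 ≤ p ∧ p < k) ∨ ((p = k ∨ p = k + 1) ∧ 2 ≤ q ∧ q < k - 1)) :
    Grow N V [(1, 2, k), (1, k, k - 1), (1, k + 1, k - 1), (1, k, k + 1), (2, k + 1, k)]
      {q | 1 ≤ q.1 ∧ q.1 ≤ k + 1 ∧ 1 ≤ q.2 ∧ q.2 ≤ k + 1 ∧ q.1 ≠ q.2 ∧ ¬ (q.1 = 2 ∧ q.2 = 1)} := by
  refine Grow.cons 1 2 k (Or.inr (Or.inl rfl)) ?_ ?_ ?_ (by omega) (by omega) (by omega) <|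
    Grow.cons (k - 1) 1 k (Or.inl rfl) ?_ ?_ ?_ (by omega) (by omega) (by omega) <|
    Grow.cons (k - 1) 1 (k + 1) (Or.inl rfl) ?_ ?_ ?_ (by omega) (by omega) (by omega) <|
    Grow.cons 1 k (k + 1) (Or.inr (Or.inl rfl)) ?_ ?_ ?_ (by omega) (by omega) (by omega) <|
    Grow.cons k 2 (k + 1) (Or.inl rfl) ?_ ?_ ?_ (by omega) (by omega) (by omega) <|
    Grow.nil_of_eq ?_
  rotate_right
  · ext ⟨p, q⟩
    simp only [Set.mem_union, Set.mem_insert_iff, Set.mem_singleton_iff, Prod.mk.injEq,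
      Set.mem_ofPred_eq, hV]
    rcases lt_or_ge p k with hp | hp
    · rcases lt_or_ge q k with hq | hq
      · have h1 : q ≠ k := by omega
        have h2 : q ≠ k + 1 := by omega
        have h3 : p ≠ k := by omega
        have h4 : p ≠ k + 1 := by omega
        simp only [h1, h2, h3, h4, hp, hq, and_false, false_and, or_false, true_and, and_true]
        omega
      · have h3 : p ≠ k := by omega
        have h4 : p ≠ k + 1 := by omega
        simp only [h3, h4, hp, false_and, or_false, true_and, and_true]
        omega
    · rcases lt_or_ge q k with hq | hq
      · have h1 : q ≠ k := by omega
        have h2 : q ≠ k + 1 := by omega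
        simp only [h1, h2, hq, and_false, false_and, or_false, false_or, true_and]
        omega
      · omega
  all_goals simp only [Set.mem_union, Set.mem_insert_iff, Set.mem_singleton_iff,
    Prod.mk.injEq, hV, true_and, and_true, true_or, or_true]
  all_goals omega

/-- The bound `N` on labels stays free because the smaller trees are used inside the larger ones. -/
theorem grow_nearlySpanningTree {n : ℕ} (hn : 2 ≤ n) : ∀ {N : ℕ}, 2 * n + 1 ≤ N →
    Grow N {(1, 2)} (nearlySpanningTree n) (visited n) := by
  induction n, hn using Nat.le_induction with
  | base => intro N hN; exact grow_nearlySpanningTree_two hN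
  | succ n hn ih =>
    intro N hN
    obtain ⟨m, rfl⟩ : ∃ m, n = m + 2 := ⟨n - 2, by omega⟩
    have h1 := ih (N := N) (by omega)
    have h2 := Grow.range' (N := N) (z := 2 * (m + 3)) (by omega) (2 * (m + 3) - 3) 2
      (visited (m + 2)) (by omega) (by omega) (by
        intro x hx hx'
        simp only [visited, Set.mem_ofPred_eq]; omega)
    have h3 := Grow.range' (N := N) (z := 2 * (m + 3) + 1) (by omega) (2 * (m + 3) - 3) 2
      (visited (m + 2) ∪ {q | (q.2 = 2 * (m + 3) ∧ 2 + 1 ≤ q.1 ∧ q.1 < 2 + (2 * (m + 3) - 3) + 1) ∨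
        (q.1 = 2 * (m + 3) ∧ 2 ≤ q.2 ∧ q.2 < 2 + (2 * (m + 3) - 3))}) (by omega) (by omega) (by
        intro x hx hx'
        refine ⟨Or.inl (?_ : _ ∈ visited (m + 2)), ?_, ?_⟩
        all_goals simp only [visited, Set.mem_union, Set.mem_ofPred_eq]; omega)
    refine ((h1.append h2).append h3).append (grow_last_edges (by omega) (by omega) ?_)
    intro p q
    simp only [visited, Set.mem_union, Set.mem_ofPred_eq]
    omega

/-! ### Relabellings that are consistent along the chains. -/

variable {n : ℕ}

/-- `Φ` relabels each class `[x,y]` in `V` to the class `[1,2]`, by even permutations. -/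
def RelabelsOn (n : ℕ) (Φ : ℕ × ℕ → OddPerm n) (V : Set (ℕ × ℕ)) : Prop :=
  ∀ q ∈ V, Φ q (lab n q.1) = lab n 1 ∧ Φ q (lab n q.2) = lab n 2 ∧ Perm.sign (Φ q) = 1

/-- `Φ` is compatible with the merging steps along the edges in `E`. -/
def CompatibleWith (n : ℕ) (Φ : ℕ × ℕ → OddPerm n) (E : List (ℕ × ℕ × ℕ)) : Prop :=
  ∀ e ∈ E, ∀ x y z, Matches e (x, y, z) →
    Φ (z, x) * cyc (lab n z) (lab n y) (lab n x) = Φ (x, y)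

/-- The values at the two new classes of an edge are forced to be `Φ (x, y) * C` and `Φ (x, y) * C *
C`. No conflict can arise because these classes are new, and the third compatibility condition is
$C^3=1$. -/
theorem Grow.exists_relabelling {V W : Set (ℕ × ℕ)} {E : List (ℕ × ℕ × ℕ)}
    (h : Grow (2 * n + 1) V E W) : ∀ Φ : ℕ × ℕ → OddPerm n, RelabelsOn n Φ V →
    ∃ Φ', RelabelsOn n Φ' W ∧ (∀ q ∈ V, Φ' q = Φ q) ∧ CompatibleWith n Φ' E := by
  induction h with
  | nil V => exact fun Φ h => ⟨Φ, h, fun _ _ => rfl, by simp [CompatibleWith]⟩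
  | @cons V W e E x y z he hV hyz hzx hne hlow hup _ ih =>
    intro Φ hΦ
    have nxy : lab n x ≠ lab n y := lab_ne hne.1 hlow.1 hup.1 hlow.2.1 hup.2.1
    have nyz : lab n y ≠ lab n z := lab_ne hne.2.1 hlow.2.1 hup.2.1 hlow.2.2 hup.2.2
    have nxz : lab n x ≠ lab n z := lab_ne hne.2.2 hlow.1 hup.1 hlow.2.2 hup.2.2
    set C := cyc (lab n z) (lab n y) (lab n x) with hC
    have Cz : C (lab n z) = lab n y := cyc_apply_left nyz.symm nxz.symm
    have Cy : C (lab n y) = lab n x := cyc_apply_mid nxz.symm nxy.symm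
    have Cx : C (lab n x) = lab n z := cyc_apply_right _ _ _
    have C3 : C * C * C = 1 := cyc_pow_three nyz.symm nxz.symm nxy.symm
    have C1 : cyc (lab n x) (lab n z) (lab n y) = C := (cyc_rotate nxz nxy nyz.symm).symm
    have C2 : cyc (lab n y) (lab n x) (lab n z) = C := cyc_rotate nyz.symm nxz.symm nxy.symm
    have Cs : Perm.sign C = 1 := sign_cyc nyz.symm nxy.symm
    obtain ⟨g1, g2, g3⟩ := hΦ _ hV
    have e1 : ((y, z) : ℕ × ℕ) ≠ (z, x) := by simp only [ne_eq, Prod.mk.injEq]; omega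
    obtain ⟨Φ', h1, h2, h3⟩ := ih
      (Function.update (Function.update Φ (y, z) (Φ (x, y) * C)) (z, x) (Φ (x, y) * C * C)) (by
        rintro q (hq | rfl | rfl)
        · have q1 : q ≠ (y, z) := by rintro rfl; exact hyz hq
          have q2 : q ≠ (z, x) := by rintro rfl; exact hzx hq
          rw [Function.update_of_ne q2, Function.update_of_ne q1]
          exact hΦ q hq
        · rw [Function.update_of_ne e1, Function.update_self]
          simp only [Perm.mul_apply, Cy, Cz, g1, g2, Perm.sign_mul, g3, Cs, mul_one, and_self]
        · rw [Function.update_self]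
          simp only [Perm.mul_apply, Cx, Cy, Cz, g1, g2, Perm.sign_mul, g3, Cs, mul_one, and_self])
    have hxy' : Φ' (x, y) = Φ (x, y) := by
      rw [h2 _ (Or.inl hV), Function.update_of_ne, Function.update_of_ne]
      · rintro h; exact hyz (h ▸ hV)
      · rintro h; exact hzx (h ▸ hV)
    have hyz' : Φ' (y, z) = Φ (x, y) * C := by
      rw [h2 _ (Or.inr (Or.inl rfl)), Function.update_of_ne e1, Function.update_self]
    have hzx' : Φ' (z, x) = Φ (x, y) * C * C := by
      rw [h2 _ (Or.inr (Or.inr rfl)), Function.update_self]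
    refine ⟨Φ', h1, ?_, ?_⟩
    · intro q hq
      rw [h2 _ (Or.inl hq), Function.update_of_ne, Function.update_of_ne]
      · rintro rfl; exact hyz hq
      · rintro rfl; exact hzx hq
    · intro e' he' x' y' z' hm
      rcases List.mem_cons.1 he' with rfl | he'
      · rcases he.eq_or hm with ⟨rfl, rfl, rfl⟩ | ⟨rfl, rfl, rfl⟩ | ⟨rfl, rfl, rfl⟩
        · rw [hxy', hzx', ← hC, mul_assoc, mul_assoc, ← mul_assoc C, C3, mul_one]
        · rw [hxy', hyz', C1]
        · rw [hyz', hzx', C2]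
      · exact h3 e' he' x' y' z' hm

/-- `Φ` relabels the permutations of every chain consistently to its first necklace. -/
structure IsRelabelling (n : ℕ) (Φ : ℕ × ℕ → OddPerm n) : Prop where
  one : Φ (1, 2) = 1
  relabels : RelabelsOn n Φ (visited n)
  compatible : CompatibleWith n Φ (nearlySpanningTree n)

theorem exists_isRelabelling (hn : 3 ≤ n) : ∃ Φ, IsRelabelling n Φ := by
  obtain ⟨Φ, h1, h2, h3⟩ := (grow_nearlySpanningTree (n := n) (by omega) le_rfl).exists_relabelling
    (fun _ => 1) (by rintro q rfl; simp)
  exact ⟨Φ, h2 _ rfl, h1, h3⟩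

/-- The permutation in the class `[1,2]` from which `p` is reached along its chain. -/
def root (Φ : ℕ × ℕ → OddPerm n) (p : OddPerm n) : OddPerm n := Φ (lastThree p).2 * p

theorem Neck.root (hn : 3 ≤ n) (Φ : ℕ × ℕ → OddPerm n) {p q : OddPerm n} (h : Neck p q) :
    Neck (root Φ p) (root Φ q) := by
  rw [RankModulation.root, RankModulation.root, h.lastThree_snd hn]
  exact h.mul_left _

/-- This is the purpose of compatibility: the necklace of the root becomes an invariant of the
chain. -/
theorem CompatibleWith.root_mul_lastRot (hn : 3 ≤ n) {Φ : ℕ × ℕ → OddPerm n}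
    {E : List (ℕ × ℕ × ℕ)} (h : CompatibleWith n Φ E) {e : ℕ × ℕ × ℕ} (he : e ∈ E) {p : OddPerm n}
    (hp : Matches e (lastThree p)) : root Φ (p * lastRot n) = root Φ p := by
  obtain ⟨⟨z, x, y⟩, hl⟩ : ∃ t, lastThree p = t := ⟨_, rfl⟩
  rw [hl] at hp
  rw [root, root, lastThree_mul_lastRot hn hl, hl, mul_lastRot_of_lastThree hl, ← mul_assoc,
    h e he x y z hp.rotate]

theorem Matches.mul_lastRot (hn : 3 ≤ n) {e : ℕ × ℕ × ℕ} {p : OddPerm n}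
    (hp : Matches e (lastThree p)) : Matches e (lastThree (p * lastRot n)) := by
  obtain ⟨⟨z, x, y⟩, hl⟩ : ∃ t, lastThree p = t := ⟨_, rfl⟩
  rw [lastThree_mul_lastRot hn hl]
  exact (hl ▸ hp).rotate.rotate

/-! ### Which permutations lie in a chain. -/

theorem mem_mergeEdge (hn : 3 ≤ n) {L : List (OddPerm n)} {e : ℕ × ℕ × ℕ} {q : OddPerm n} :
    q ∈ mergeEdge L e ↔ q ∈ L ∨ ∃ p ∈ L, Matches e (lastThree p) ∧
      (Neck (p * lastRot n) q ∨ Neck (p * lastRot n * lastRot n) q) := by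
  have h1 (p q : OddPerm n) : Neck (tLow p) q ↔ Neck p q :=
    ⟨(neck_tLow p).trans, (neck_tLow p).symm.trans⟩
  -- The inserted necklace ends one step before its period $2n-1$ is complete, hence at `p * lastRot
  -- n`.
  have h2 (p : OddPerm n) : tLow^[2 * n - 2] (tTop p) = p * lastRot n := by
    rw [tTop_eq hn, ← Function.iterate_succ_apply,
      show (2 * n - 2).succ = 2 * n - 1 by omega, tLow_iterate_period hn]
  simp only [mergeEdge, List.mem_flatMap]
  constructor
  · rintro ⟨p, hp, hq⟩
    split_ifs at hq with h
    · simp only [List.mem_cons, List.mem_append, mem_necklaceList hn, h2] at hq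
      rcases hq with rfl | hq | hq
      · exact Or.inl hp
      · rw [tTop_eq hn, h1] at hq; exact Or.inr ⟨p, hp, h, Or.inl hq⟩
      · rw [tTop_eq hn, h1] at hq; exact Or.inr ⟨p, hp, h, Or.inr hq⟩
    · rw [List.mem_singleton.1 hq]; exact Or.inl hp
  · rintro (hq | ⟨p, hp, h, hq⟩)
    · refine ⟨q, hq, ?_⟩
      split_ifs <;> simp
    · refine ⟨p, hp, ?_⟩
      unfold Matches at h
      rw [if_pos h]
      simp only [List.mem_cons, List.mem_append, mem_necklaceList hn, h2]
      simp only [tTop_eq hn, h1]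
      exact Or.inr hq

/-- The invariant passes to the new classes in both directions. Of the three rotations of a triple
only the one in $[x,y]$ can be in the list, and rotating keeps its root. Conversely, any `q` in a
new class has on its necklace a member that ends with the triple, and the rotation of this member
into $[x,y]$ has a root on the right necklace, so it is already in the list. -/
theorem Grow.mem_foldl_mergeEdge (hn : 3 ≤ n) {Φ : ℕ × ℕ → OddPerm n} {π : OddPerm n}
    {V W : Set (ℕ × ℕ)} {E : List (ℕ × ℕ × ℕ)} (h : Grow (2 * n + 1) V E W) :
    ∀ L : List (OddPerm n), CompatibleWith n Φ E →
    (∀ p, p ∈ L ↔ (lastThree p).2 ∈ V ∧ Neck π (root Φ p)) →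
    ∀ p, p ∈ E.foldl mergeEdge L ↔ (lastThree p).2 ∈ W ∧ Neck π (root Φ p) := by
  induction h with
  | nil V => intro L _ h; exact h
  | @cons V W e E x y z he hV hyz hzx hne hlow hup _ ih =>
    intro L hE hL
    refine ih (mergeEdge L e) (fun e' he' => hE e' (List.mem_cons_of_mem _ he')) ?_
    have hr {p : OddPerm n} (hp : Matches e (lastThree p)) :=
      hE.root_mul_lastRot hn List.mem_cons_self hp
    intro q
    rw [mem_mergeEdge hn]
    constructor
    · rintro (hq | ⟨p, hp, hm, hq⟩)
      · exact ⟨Or.inl ((hL q).1 hq).1, ((hL q).1 hq).2⟩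
      · have hpV := (hL p).1 hp
        have hl : lastThree p = (z, x, y) := by
          obtain ⟨⟨a, b, c⟩, hl⟩ : ∃ t, lastThree p = t := ⟨_, rfl⟩
          rw [hl] at hm hpV
          rcases he.eq_or hm with ⟨rfl, rfl, rfl⟩ | ⟨rfl, rfl, rfl⟩ | ⟨rfl, rfl, rfl⟩
          · exact absurd hpV.1 hyz
          · exact absurd hpV.1 hzx
          · exact hl
        have hl1 := lastThree_mul_lastRot hn hl
        have hl2 := lastThree_mul_lastRot hn hl1
        rcases hq with hq | hq
        · refine ⟨Or.inr (Or.inr ?_), hpV.2.trans ?_⟩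
          · rw [hq.lastThree_snd hn, hl1]; rfl
          · rw [← hr hm]; exact hq.root hn Φ
        · refine ⟨Or.inr (Or.inl ?_), hpV.2.trans ?_⟩
          · rw [hq.lastThree_snd hn, hl2]
          · rw [← hr hm, ← hr (hm.mul_lastRot hn)]; exact hq.root hn Φ
    · rintro ⟨hq | hq | hq, hN⟩
      · exact Or.inl ((hL q).2 ⟨hq, hN⟩)
      · obtain ⟨p, hp, hl⟩ := exists_neck_lastThree hn q hq hlow.1 hup.1 hne.1 hne.2.2
        have hl1 := lastThree_mul_lastRot hn hl
        have hm : Matches e (lastThree p) := by rw [hl]; exact he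
        refine Or.inr ⟨p * lastRot n, (hL _).2 ⟨?_, ?_⟩, hm.mul_lastRot hn, Or.inr ?_⟩
        · rw [hl1]; exact hV
        · rw [hr hm]; exact hN.trans (hp.root hn Φ)
        · rw [mul_lastRot_three hn]
          exact hp.symm
      · obtain ⟨p, hp, hl⟩ := exists_neck_lastThree hn q hq hlow.2.1 hup.2.1 hne.2.1 hne.1.symm
        have hl1 := lastThree_mul_lastRot hn hl
        have hl2 := lastThree_mul_lastRot hn hl1
        have hm : Matches e (lastThree p) := by rw [hl]; exact he.rotate
        have hm1 := hm.mul_lastRot hn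
        refine Or.inr ⟨p * lastRot n * lastRot n, (hL _).2 ⟨?_, ?_⟩, hm1.mul_lastRot hn, Or.inl ?_⟩
        · rw [hl2]; exact hV
        · rw [hr hm1, hr hm]; exact hN.trans (hp.root hn Φ)
        · rw [mul_lastRot_three hn]
          exact hp.symm

theorem mem_chainOf (hn : 3 ≤ n) {Φ : ℕ × ℕ → OddPerm n} (hΦ : IsRelabelling n Φ) {π : OddPerm n}
    (hπ : (lastThree π).2 = (1, 2)) {p : OddPerm n} :
    p ∈ chainOf π ↔ (lastThree p).2 ∈ visited n ∧ Neck π (root Φ p) := by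
  rw [chainOf, Cycle.mem_coe_iff]
  refine (grow_nearlySpanningTree (n := n) (by omega) le_rfl).mem_foldl_mergeEdge hn _
    hΦ.compatible (fun p => ?_) p
  rw [mem_necklaceList hn, Set.mem_singleton_iff]
  constructor
  · intro h
    have h1 : (lastThree p).2 = (1, 2) := (h.lastThree_snd hn).trans hπ
    refine ⟨h1, ?_⟩
    rwa [root, h1, hΦ.one, one_mul]
  · rintro ⟨h1, h⟩
    rwa [root, h1, hΦ.one, one_mul] at h

theorem mergeEdge_isRotated {L L' : List (OddPerm n)} (e : ℕ × ℕ × ℕ) (h : L ~r L') :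
    mergeEdge L e ~r mergeEdge L' e := by
  obtain ⟨k, hk, rfl⟩ := List.isRotated_iff_mod.1 h
  rw [List.rotate_eq_drop_append_take hk]
  conv_lhs => rw [← List.take_append_drop k L]
  simp only [mergeEdge, List.flatMap_append]
  exact List.isRotated_append

/-- `mergeEdge` acts entry by entry, so rotating the first necklace only rotates the final list.
Chains thus depend only on a necklace in $[1,2]$. -/
theorem chainOf_eq_of_neck (hn : 3 ≤ n) {π π' : OddPerm n} (h : Neck π π') :
    chainOf π = chainOf π' := by
  have h1 : necklaceList π ~r necklaceList π' := by
    rw [← mem_necklaceList hn, necklaceList, List.mem_map] at h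
    obtain ⟨k, -, rfl⟩ := h
    induction k with
    | zero => exact List.IsRotated.refl _
    | succ k ih =>
      rw [Function.iterate_succ_apply']
      exact ih.trans (necklaceList_tLow hn _)
  rw [chainOf, chainOf, Cycle.coe_eq_coe]
  induction nearlySpanningTree n using List.reverseRecOn with
  | nil => exact h1
  | append_singleton E e ih =>
    rw [List.foldl_append, List.foldl_append]
    exact mergeEdge_isRotated e ih

end RankModulation

namespace RankModulation

open Equiv

/-! ### Connecting the permutations of a set of labels with distinct colours -/

section zmod

variable {L : ℕ}

theorem natCast_zmod_ne_zero (hL : 4 ≤ L) {k : ℕ} (h0 : k ≠ 0) (hk : k < 4) :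
    (k : ZMod L) ≠ 0 := by
  rw [ne_eq, ZMod.natCast_eq_zero_iff]
  intro h
  have := Nat.le_of_dvd (by omega) h
  omega

theorem one_two_three_ne_zero (hL : 4 ≤ L) :
    (1 : ZMod L) ≠ 0 ∧ (2 : ZMod L) ≠ 0 ∧ (3 : ZMod L) ≠ 0 := by
  refine ⟨?_, ?_, ?_⟩
  · exact_mod_cast natCast_zmod_ne_zero hL (k := 1) (by omega) (by omega)
  · exact_mod_cast natCast_zmod_ne_zero hL (k := 2) (by omega) (by omega)
  · exact_mod_cast natCast_zmod_ne_zero hL (k := 3) (by omega) (by omega)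

/-- The two positions that are joined by the colour `(p, q)`. -/
def joined (P : ZMod L × ZMod L) : ZMod L × ZMod L :=
  if P.1 = P.2 - 1 then (P.2 - 2, P.2 - 3)
  else (P.2 - 1, if P.1 = P.2 - 2 then P.2 + 1 else P.1 + 1)

theorem joined_ne (hL : 4 ≤ L) {P : ZMod L × ZMod L} (hP : P.1 ≠ P.2) :
    (joined P).1 ≠ (joined P).2 ∧ (joined P).1 ≠ P.1 ∧ (joined P).1 ≠ P.2 ∧
      (joined P).2 ≠ P.1 ∧ (joined P).2 ≠ P.2 := by
  obtain ⟨p, q⟩ := P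
  obtain ⟨h1, h2, h3⟩ := one_two_three_ne_zero hL
  simp only at hP
  unfold joined
  simp only
  split_ifs with h h'
  · subst h
    refine ⟨?_, ?_, ?_, ?_, ?_⟩ <;> intro e
    · exact h1 (by linear_combination e)
    · exact h1 (by linear_combination -e)
    · exact h2 (by linear_combination -e)
    · exact h2 (by linear_combination -e)
    · exact h3 (by linear_combination -e)
  · subst h'
    refine ⟨?_, ?_, ?_, ?_, ?_⟩ <;> intro e
    · exact h2 (by linear_combination -e)
    · exact h1 (by linear_combination e)
    · exact h1 (by linear_combination -e)
    · exact h3 (by linear_combination e)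
    · exact h1 (by linear_combination e)
  · refine ⟨?_, ?_, ?_, ?_, ?_⟩ <;> intro e
    · exact h' (by linear_combination -e)
    · exact h e.symm
    · exact h1 (by linear_combination -e)
    · exact h1 (by linear_combination e)
    · exact h (by linear_combination e)

/-- For fixed $q$ the colours $(p,q)$ with $p\ne q-1$ form a star: its centre is $(q-1,q)$ and its
leaves are all other $(s,q)$. The colour $(q-1,q)$ joins $(q-1,q-2)$ to $(q-1,q-3)$, hence the stars
of $q-2$ and $q-3$. These links arrange the stars in a ring; leaving out the colour $(q_0-1,q_0)$
cuts the ring into a path, which is still connected. -/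
theorem rel_of_joined (hL : 4 ≤ L) (q₀ : ZMod L) {E : ZMod L × ZMod L → ZMod L × ZMod L → Prop}
    (symm : ∀ {P Q}, E P Q → E Q P) (trans : ∀ {P Q R}, E P Q → E Q R → E P R)
    (hE : ∀ P : ZMod L × ZMod L, P.1 ≠ P.2 → P ≠ (q₀ - 1, q₀) →
      (P.1 ≠ P.2 - 1 → E ((joined P).1, P.2) ((joined P).2, P.2)) ∧
      (P.1 = P.2 - 1 → E (P.1, (joined P).1) (P.1, (joined P).2)))
    {P Q : ZMod L × ZMod L} (hP : P.1 ≠ P.2) (hQ : Q.1 ≠ Q.2) : E P Q := by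
  obtain ⟨h1, h2, h3⟩ := one_two_three_ne_zero hL
  have leaf (q s : ZMod L) (hs : s ≠ q) (hs' : s ≠ q - 1) : E (q - 1, q) (s, q) := by
    -- The leaf $s$ is reached by the colour $p=s-1$, except that $s=q+1$ would need $p=q$. Its
    -- colour is $p=q-2$, whose successor is the centre.
    by_cases h : s = q + 1
    · subst h
      have e1 : q - 2 ≠ q - 1 := fun e => h1 (by linear_combination -e)
      have := (hE (q - 2, q) (fun e => h2 (by linear_combination -e)) (by
        intro e; simp only [Prod.mk.injEq] at e; exact e1 (by rw [e.1, e.2]))).1 e1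
      simpa [joined, e1] using this
    · have e1 : s - 1 ≠ q - 1 := fun e => hs (by linear_combination e)
      have e2 : s - 1 ≠ q - 2 := fun e => hs' (by linear_combination e)
      have := (hE (s - 1, q) (fun e => h (by linear_combination e)) (by
        intro e; simp only [Prod.mk.injEq] at e; exact e1 (by rw [e.1, e.2]))).1 e1
      simpa only [joined, e1, e2, if_false, sub_add_cancel] using this
  have centre (q s : ZMod L) (hs : s ≠ q) : E (q - 1, q) (s, q) := by
    by_cases h : s = q - 1
    · have h' := leaf q (q + 1) (fun e => h1 (by linear_combination e))
        (fun e => h2 (by linear_combination e))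
      subst h
      exact trans h' (symm h')
    · exact leaf q s hs h
  have row (q r s : ZMod L) (hr : r ≠ q) (hs : s ≠ q) : E (r, q) (s, q) :=
    trans (symm (centre q r hr)) (centre q s hs)
  have adj (r : ZMod L) (hr : r ≠ q₀ - 2) : E (r - 1, r) (r - 2, r - 1) := by
    have e0 : r + 1 ≠ r + 2 := fun e => h1 (by linear_combination -e)
    have e1 : r + 1 = r + 2 - 1 := by ring
    have e2 := (hE (r + 1, r + 2) e0 (by
        intro e; simp only [Prod.mk.injEq] at e; exact hr (by linear_combination e.2))).2 e1
    have e3 : E (r + 1, r) (r + 1, r - 1) := by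
      convert e2 using 2
      · simp [joined, e1]
      · simp only [joined, e1, if_true]; ring
    have e4 := row r (r - 1) (r + 1) (fun e => h1 (by linear_combination -e))
      (fun e => h1 (by linear_combination e))
    have e5 := row (r - 1) (r + 1) (r - 2) (fun e => h2 (by linear_combination e))
      (fun e => h1 (by linear_combination -e))
    exact trans e4 (trans e3 e5)
  -- The walk starts at row $q_0-3$, just past the missing link from $q_0-2$, and descends through
  -- all rows.
  have walk (i : ℕ) (hi : i < L) :
      E (q₀ - 4, q₀ - 3) (q₀ - 3 - i - 1, q₀ - 3 - i) := by
    induction i with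
    | zero =>
      convert row (q₀ - 3) (q₀ - 4) (q₀ - 4) (fun e => h1 (by linear_combination -e))
        (fun e => h1 (by linear_combination -e)) using 2
      · push_cast; ring
      · push_cast; ring
    | succ i ih =>
      refine trans (ih (by omega)) ?_
      convert adj (q₀ - 3 - i) ?_ using 2
      · push_cast; ring
      · push_cast; ring
      · intro e
        have : ((i + 1 : ℕ) : ZMod L) = 0 := by push_cast; linear_combination -e
        rw [ZMod.natCast_eq_zero_iff] at this
        have := Nat.le_of_dvd (by omega) this
        omega
  have : NeZero L := ⟨by omega⟩
  have reach (P : ZMod L × ZMod L) (hP : P.1 ≠ P.2) : E (q₀ - 4, q₀ - 3) P := by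
    obtain ⟨p, q⟩ := P
    refine trans (walk (q₀ - 3 - q).val (ZMod.val_lt _)) ?_
    rw [ZMod.natCast_zmod_val]
    convert centre q p hP using 2 <;> ring
  exact trans (symm (reach P hP)) (reach Q hQ)

end zmod

section perms

variable {α : Type*}

/-- The permutations that fix everything outside of `K`. -/
def permsOn (K : Set α) : Subgroup (Perm α) where
  carrier := {u | ∀ l, l ∉ K → u l = l}
  mul_mem' := by
    intro u v hu hv l hl
    rw [Perm.mul_apply, hv l hl, hu l hl]
  one_mem' := fun _ _ => rfl
  inv_mem' := by
    intro u hu l hl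
    rw [Perm.inv_eq_iff_eq, hu l hl]

theorem permsOn_apply_mem {K : Set α} {u : Perm α} (hu : u ∈ permsOn K) {l : α} (hl : l ∈ K) :
    u l ∈ K := by
  by_contra h
  have := hu _ h
  exact h ((u.injective this).symm ▸ hl)

theorem permsOn_mono {K K' : Set α} (h : K ⊆ K') : permsOn K ≤ permsOn K' :=
  fun _ hu l hl => hu l fun h' => hl (h h')

variable [DecidableEq α]

theorem swap_mem_permsOn {K : Set α} {a b : α} (ha : a ∈ K) (hb : b ∈ K) :
    swap a b ∈ permsOn K := fun l hl =>
  swap_apply_of_ne_of_ne (by rintro rfl; exact hl ha) (by rintro rfl; exact hl hb)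

theorem exists_permsOn_apply_eq {K : Set α} {u : Perm α} (hu : u ∈ permsOn K) {p t : α}
    (hp : p ∈ K) (ht : t ∈ K) :
    ∃ u' ∈ permsOn K, u' p = t ∧ ∀ p', p' ≠ p → u p' ≠ t → u' p' = u p' :=
  ⟨swap (u p) t * u, mul_mem (swap_mem_permsOn (permsOn_apply_mem hu hp) ht) hu, by simp,
    fun _ h h' => by
      rw [Perm.mul_apply, swap_apply_of_ne_of_ne (fun e => h (u.injective e)) h']⟩

/-- The parity is corrected by exchanging `A` and `B`, whence the alternative in the conclusion. -/
theorem exists_even_permsOn [Fintype α] {K : Set α} {p q r s X Y A B : α}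
    (hp : p ∈ K) (hq : q ∈ K) (hr : r ∈ K) (hs : s ∈ K) (hX : X ∈ K) (hY : Y ∈ K) (hA : A ∈ K)
    (hB : B ∈ K) (hpq : p ≠ q) (hpr : p ≠ r) (hps : p ≠ s) (hqr : q ≠ r) (hqs : q ≠ s)
    (hrs : r ≠ s) (hXY : X ≠ Y) (hXA : X ≠ A) (hXB : X ≠ B) (hYA : Y ≠ A) (hYB : Y ≠ B)
    (hAB : A ≠ B) : ∃ u ∈ permsOn K, Perm.sign u = 1 ∧ u p = X ∧ u q = Y ∧
      ((u r = A ∧ u s = B) ∨ (u r = B ∧ u s = A)) := by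
  obtain ⟨u₁, m₁, a₁, -⟩ := exists_permsOn_apply_eq (one_mem (permsOn K)) hp hX
  obtain ⟨u₂, m₂, a₂, b₂⟩ := exists_permsOn_apply_eq m₁ hq hY
  have c₂ : u₂ p = X := by rw [b₂ p hpq (by rwa [a₁]), a₁]
  obtain ⟨u₃, m₃, a₃, b₃⟩ := exists_permsOn_apply_eq m₂ hr hA
  have c₃ : u₃ p = X := by rw [b₃ p hpr (by rwa [c₂]), c₂]
  have d₃ : u₃ q = Y := by rw [b₃ q hqr (by rwa [a₂]), a₂]
  obtain ⟨u, m, a, b⟩ := exists_permsOn_apply_eq m₃ hs hB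
  have c : u p = X := by rw [b p hps (by rwa [c₃]), c₃]
  have d : u q = Y := by rw [b q hqs (by rwa [d₃]), d₃]
  have e : u r = A := by rw [b r hrs (by rwa [a₃]), a₃]
  rcases Int.units_eq_one_or (Perm.sign u) with h | h
  · exact ⟨u, m, h, c, d, Or.inl ⟨e, a⟩⟩
  · refine ⟨swap A B * u, mul_mem (swap_mem_permsOn hA hB) m, ?_, ?_, ?_, Or.inr ⟨?_, ?_⟩⟩
    · rw [Perm.sign_mul, Perm.sign_swap hAB, h]; rfl
    · rw [Perm.mul_apply, c, swap_apply_of_ne_of_ne hXA hXB]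
    · rw [Perm.mul_apply, d, swap_apply_of_ne_of_ne hYA hYB]
    · rw [Perm.mul_apply, e, swap_apply_left]
    · rw [Perm.mul_apply, a, swap_apply_right]

theorem eq_one_or_eq_swap {a c : α} {u : Perm α} (hu : u ∈ permsOn {a, c}) :
    u = 1 ∨ u = swap a c := by
  have ha : u a = a ∨ u a = c := permsOn_apply_mem hu (Or.inl rfl)
  have hc : u c = a ∨ u c = c := permsOn_apply_mem hu (Or.inr rfl)
  by_cases hac : a = c
  · subst hac
    left; ext l
    by_cases h : l = a
    · subst h; simpa using ha
    · exact hu l (by simpa using h)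
  rcases ha with ha | ha
  · left; ext l
    by_cases h : l = a
    · subst h; exact ha
    by_cases h' : l = c
    · subst h'; exact hc.resolve_left fun e => h (u.injective (e.trans ha.symm))
    · exact hu l (by simp [h, h'])
  · right; ext l
    by_cases h : l = a
    · subst h; rw [ha, swap_apply_left]
    by_cases h' : l = c
    · subst h'
      rw [swap_apply_right]
      exact hc.resolve_right fun e => h (u.injective (e.trans ha.symm))
    · rw [swap_apply_of_ne_of_ne h h']
      exact hu l (by simp [h, h'])

variable [Fintype α] (κ : ℕ → α) (b : ℕ → Perm α)

/-- The edge with the colour `u` joins `(κ₀ κ_i) u` and `b_i u` for `i = x u`; the colours are the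
even permutations of `κ_0, …, κ_{L-1}` other than the identity. -/
def ColourEdge (L : ℕ) (x : Perm α → ℕ) (v w : Perm α) : Prop :=
  ∃ u ∈ permsOn (κ '' Set.Iio L), Perm.sign u = 1 ∧ u ≠ 1 ∧
    v = swap (κ 0) (κ (x u)) * u ∧ w = b (x u) * u

/-- There is a choice of edges, one for each colour, that connects the odd permutations of
`κ_0, …, κ_{L-1}`. -/
def Connectable (L : ℕ) : Prop :=
  ∃ x : Perm α → ℕ, (∀ u ∈ permsOn (κ '' Set.Iio L), Perm.sign u = 1 → u ≠ 1 →
      2 ≤ x u ∧ x u < L) ∧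
    ∀ v ∈ permsOn (κ '' Set.Iio L), ∀ w ∈ permsOn (κ '' Set.Iio L), Perm.sign v = -1 →
      Perm.sign w = -1 → Relation.EqvGen (ColourEdge κ b L x) v w

variable {κ b}

/-- With two labels there is one odd permutation and no colour. -/
theorem connectable_two (hκ : Set.InjOn κ (Set.Iio 2)) : Connectable κ b 2 := by
  have h01 : κ 0 ≠ κ 1 := fun e => by
    have := hκ (by simp : (0 : ℕ) ∈ Set.Iio 2) (by simp : (1 : ℕ) ∈ Set.Iio 2) e
    omega
  have hK : κ '' Set.Iio 2 = {κ 0, κ 1} := by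
    have : Set.Iio 2 = ({0, 1} : Set ℕ) := by ext i; simp; omega
    rw [this, Set.image_pair]
  rw [Connectable, hK]
  refine ⟨fun _ => 0, ?_, ?_⟩
  · intro u hu hs h1
    rcases eq_one_or_eq_swap hu with rfl | rfl
    · exact absurd rfl h1
    · rw [Perm.sign_swap h01] at hs; exact absurd hs (by decide)
  · intro v hv w hw hsv hsw
    rcases eq_one_or_eq_swap hv with rfl | rfl
    · rw [Perm.sign_one] at hsv; exact absurd hsv (by decide)
    rcases eq_one_or_eq_swap hw with rfl | rfl
    · rw [Perm.sign_one] at hsw; exact absurd hsw (by decide)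
    exact Relation.EqvGen.refl _


/-- Sort permutations by the positions $(p,q)$ of the new labels $X,Y$. The members of one sort are
the right translates by a fixed even `c P` of the permutations of the old labels. The induction
hypothesis, translated by `c P`, connects the odd ones among them and uses all colours of the sort
except `c P`. The colours `c P` are left to connect the sorts: with `2 * k` such a colour moves $X$
to the place of $\kappa_0$ on one side and of $\kappa_{2k-1}$ on the other while $Y$ stays, and with
`2 * k + 1` it does the same for $Y$. Placing $\kappa_0,\kappa_{2k-1}$ at the positions `joined P`
reduces the claim to `rel_of_joined`. -/
theorem Connectable.add_two {k : ℕ} (hk : 1 ≤ k) (hκ : Set.InjOn κ (Set.Iio (2 * k + 2)))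
    (hb : ∀ i, i = 2 * k ∨ i = 2 * k + 1 → Perm.sign (b i) = -1 ∧ b i (κ (2 * k - 1)) = κ i ∧
      b i ∈ permsOn (κ '' (Set.Iio (2 * k) ∪ {i})))
    (h : Connectable κ b (2 * k)) : Connectable κ b (2 * k + 2) := by
  classical
  set L := 2 * k + 2 with hL
  have : NeZero L := ⟨by omega⟩
  have : Nonempty (ZMod L) := ⟨0⟩
  set K : Set α := κ '' Set.Iio L with hK
  have mK {i : ℕ} (hi : i < L) : κ i ∈ K := ⟨i, hi, rfl⟩
  have κne {i j : ℕ} (hi : i < L) (hj : j < L) (hij : i ≠ j) : κ i ≠ κ j :=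
    fun e => hij (hκ hi hj e)
  let ι : ZMod L → α := fun z => κ z.val
  have ιinj : Function.Injective ι := fun z w e =>
    ZMod.val_injective L (hκ (ZMod.val_lt z) (ZMod.val_lt w) e)
  have ιK (z : ZMod L) : ι z ∈ K := mK (ZMod.val_lt z)
  have ιcast {i : ℕ} (hi : i < L) : ι (i : ZMod L) = κ i := by
    simp only [ι, ZMod.val_natCast, Nat.mod_eq_of_lt hi]
  have ιpos {l : α} (hl : l ∈ K) : ι (Function.invFun ι l) = l := by
    obtain ⟨i, hi, rfl⟩ := hl
    exact Function.invFun_eq ⟨(i : ZMod L), ιcast hi⟩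
  have ιinv (z : ZMod L) : Function.invFun ι (ι z) = z := Function.leftInverse_invFun ιinj z
  set X := κ (2 * k) with hX
  set Y := κ (2 * k + 1) with hY
  have mX : X ∈ K := mK (by omega)
  have mY : Y ∈ K := mK (by omega)
  have XY : X ≠ Y := κne (by omega) (by omega) (by omega)
  let node : Perm α → ZMod L × ZMod L := fun u =>
    (Function.invFun ι (u⁻¹ X), Function.invFun ι (u⁻¹ Y))
  have node_iff {u : Perm α} (hu : u ∈ permsOn K) (P : ZMod L × ZMod L) :
      node u = P ↔ u (ι P.1) = X ∧ u (ι P.2) = Y := by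
    have h1 : u⁻¹ X ∈ K := permsOn_apply_mem (inv_mem hu) mX
    have h2 : u⁻¹ Y ∈ K := permsOn_apply_mem (inv_mem hu) mY
    obtain ⟨p, q⟩ := P
    simp only [node, Prod.mk.injEq]
    refine and_congr ?_ ?_
    · rw [← ιinj.eq_iff, ιpos h1, Perm.inv_eq_iff_eq, eq_comm]
    · rw [← ιinj.eq_iff, ιpos h2, Perm.inv_eq_iff_eq, eq_comm]
  have node_ne {u : Perm α} (hu : u ∈ permsOn K) : (node u).1 ≠ (node u).2 := by
    obtain ⟨h1, h2⟩ := (node_iff hu _).1 rfl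
    intro e
    rw [e, h2] at h1
    exact XY h1.symm
  set q₀ : ZMod L := ((2 * k + 1 : ℕ) : ZMod L) with hq₀
  have hq₁ : q₀ - 1 = ((2 * k : ℕ) : ZMod L) := by rw [hq₀]; push_cast; ring
  have node_one : node 1 = (q₀ - 1, q₀) := by
    rw [node_iff (one_mem _), hq₁]
    exact ⟨ιcast (by omega), ιcast (by omega)⟩
  -- The sort of the identity gets `c P = 1`; the colour 1 is not available, and this is the one
  -- sort whose link is not needed.
  have hc (P : ZMod L × ZMod L) : ∃ c ∈ permsOn K, P.1 ≠ P.2 → Perm.sign c = 1 ∧ node c = P ∧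
      (P = (q₀ - 1, q₀) → c = 1) ∧ (P ≠ (q₀ - 1, q₀) →
        (c (ι (joined P).1) = κ 0 ∧ c (ι (joined P).2) = κ (2 * k - 1)) ∨
        (c (ι (joined P).1) = κ (2 * k - 1) ∧ c (ι (joined P).2) = κ 0)) := by
    by_cases hP : P.1 ≠ P.2
    swap
    · exact ⟨1, one_mem _, fun h => absurd h hP⟩
    by_cases hP₀ : P = (q₀ - 1, q₀)
    · exact ⟨1, one_mem _, fun _ => ⟨Perm.sign_one, hP₀ ▸ node_one, fun _ => rfl,
        fun h => absurd hP₀ h⟩⟩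
    obtain ⟨j1, j2, j3, j4, j5⟩ := joined_ne (by omega : 4 ≤ L) hP
    obtain ⟨c, hcK, hc1, hc2, hc3, hc4⟩ := exists_even_permsOn (ιK P.1) (ιK P.2) (ιK (joined P).1)
      (ιK (joined P).2) mX mY (mK (i := 0) (by omega)) (mK (i := 2 * k - 1) (by omega))
      (ιinj.ne hP) (ιinj.ne j2.symm) (ιinj.ne j4.symm) (ιinj.ne j3.symm) (ιinj.ne j5.symm)
      (ιinj.ne j1) XY (κne (by omega) (by omega) (by omega)) (κne (by omega) (by omega) (by omega))
      (κne (by omega) (by omega) (by omega)) (κne (by omega) (by omega) (by omega))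
      (κne (by omega) (by omega) (by omega))
    exact ⟨c, hcK, fun _ => ⟨hc1, (node_iff hcK P).2 ⟨hc2, hc3⟩, fun h => absurd h hP₀,
      fun _ => hc4⟩⟩
  choose c cK hc using hc
  obtain ⟨x', hx', hconn⟩ := h
  let x : Perm α → ℕ := fun u =>
    if u = c (node u) then (if (node u).1 = (node u).2 - 1 then 2 * k + 1 else 2 * k)
    else x' (u * (c (node u))⁻¹)
  have sub : κ '' Set.Iio (2 * k) ⊆ K := Set.image_mono (Set.Iio_subset_Iio (by omega))
  have lower {u : Perm α} (hu : u ∈ permsOn K) (h1 : u X = X) (h2 : u Y = Y) :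
      u ∈ permsOn (κ '' Set.Iio (2 * k)) := by
    intro l hl
    by_cases hlK : l ∈ K
    · obtain ⟨i, hi, rfl⟩ := hlK
      have hi' : ¬ i < 2 * k := fun h => hl ⟨i, h, rfl⟩
      have hi'' : i < L := hi
      obtain rfl | rfl : i = 2 * k ∨ i = 2 * k + 1 := by omega
      · exact h1
      · exact h2
    · exact hu l hlK
  have fixX {u : Perm α} (hu : u ∈ permsOn (κ '' Set.Iio (2 * k))) : u X = X := by
    refine hu X ?_
    rintro ⟨i, hi, e⟩
    have hi' : i < 2 * k := hi
    exact κne (by omega) (by omega) (by omega) e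
  have fixY {u : Perm α} (hu : u ∈ permsOn (κ '' Set.Iio (2 * k))) : u Y = Y := by
    refine hu Y ?_
    rintro ⟨i, hi, e⟩
    have hi' : i < 2 * k := hi
    exact κne (by omega) (by omega) (by omega) e
  have node_mul {u : Perm α} (hu : u ∈ permsOn (κ '' Set.Iio (2 * k))) {P : ZMod L × ZMod L}
      (hP : P.1 ≠ P.2) : node (u * c P) = P := by
    obtain ⟨h1, h2⟩ := (node_iff (cK P) P).1 (hc P hP).2.1
    rw [node_iff (mul_mem (permsOn_mono sub hu) (cK P)), Perm.mul_apply, Perm.mul_apply, h1, h2,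
      fixX hu, fixY hu]
    exact ⟨rfl, rfl⟩
  have quot {u : Perm α} (hu : u ∈ permsOn K) : u * (c (node u))⁻¹ ∈
      permsOn (κ '' Set.Iio (2 * k)) := by
    obtain ⟨h1, h2⟩ := (node_iff hu _).1 rfl
    obtain ⟨h3, h4⟩ := (node_iff (cK (node u)) _).1 (hc _ (node_ne hu)).2.1
    refine lower (mul_mem hu (inv_mem (cK _))) ?_ ?_
    · rw [Perm.mul_apply, Perm.inv_eq_iff_eq.2 h3.symm, h1]
    · rw [Perm.mul_apply, Perm.inv_eq_iff_eq.2 h4.symm, h2]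
  have sign_quot {u : Perm α} (hu : u ∈ permsOn K) :
      Perm.sign (u * (c (node u))⁻¹) = Perm.sign u := by
    rw [Perm.sign_mul, Perm.sign_inv, (hc _ (node_ne hu)).1, mul_one]
  refine ⟨x, ?_, ?_⟩
  · intro u hu hs h1
    simp only [x]
    split_ifs with h2 h3
    · omega
    · omega
    · have := hx' _ (quot hu) (by rw [sign_quot hu, hs])
        (fun e => h2 (by rwa [mul_inv_eq_one] at e))
      omega
  have inner {v w : Perm α} (hv : v ∈ permsOn K) (hw : w ∈ permsOn K) (sv : Perm.sign v = -1)
      (sw : Perm.sign w = -1) (hvw : node v = node w) :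
      Relation.EqvGen (ColourEdge κ b L x) v w := by
    have key : ∀ v' w', Relation.EqvGen (ColourEdge κ b (2 * k) x') v' w' →
        Relation.EqvGen (ColourEdge κ b L x) (v' * c (node v)) (w' * c (node v)) := by
      intro v' w' h
      induction h with
      | rel v' w' h =>
        refine Relation.EqvGen.rel _ _ ?_
        obtain ⟨u, hu, su, u1, rfl, rfl⟩ := h
        have hn := node_mul hu (node_ne hv)
        have hne : u * c (node v) ≠ c (node (u * c (node v))) := by
          rw [hn]; intro e; exact u1 (mul_eq_right.1 e)
        have hx : x (u * c (node v)) = x' u := by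
          simp only [x, if_neg hne]
          rw [hn, mul_inv_cancel_right]
        refine ⟨u * c (node v), mul_mem (permsOn_mono sub hu) (cK _), ?_, ?_, ?_, ?_⟩
        · rw [Perm.sign_mul, su, (hc _ (node_ne hv)).1, mul_one]
        · intro e
          have e1 : node v = (q₀ - 1, q₀) := by rw [← hn, e, node_one]
          rw [(hc _ (node_ne hv)).2.2.1 e1, mul_one] at e
          exact u1 e
        · rw [hx, mul_assoc]
        · rw [hx, mul_assoc]
      | refl v' => exact Relation.EqvGen.refl _
      | symm v' w' _ ih => exact ih.symm
      | trans _ _ _ _ _ ih1 ih2 => exact ih1.trans _ _ _ ih2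
    have := key _ _ (hconn _ (quot hv) _ (quot hw) (by rw [sign_quot hv, sv])
      (by rw [sign_quot hw, sw]))
    rwa [inv_mul_cancel_right, hvw, inv_mul_cancel_right] at this
  intro v hv w hw sv sw
  obtain ⟨v', w', hv', hw', sv', sw', nv, nw, hvw⟩ := rel_of_joined (by omega : 4 ≤ L) q₀
    (E := fun P Q => ∃ v w, v ∈ permsOn K ∧ w ∈ permsOn K ∧ Perm.sign v = -1 ∧ Perm.sign w = -1 ∧
      node v = P ∧ node w = Q ∧ Relation.EqvGen (ColourEdge κ b L x) v w)
    (by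
      rintro P Q ⟨v, w, hv, hw, sv, sw, nv, nw, h⟩
      exact ⟨w, v, hw, hv, sw, sv, nw, nv, h.symm⟩)
    (by
      rintro P Q R ⟨v, w, hv, hw, sv, sw, nv, nw, h⟩ ⟨v', w', hv', hw', sv', sw', nv', nw', h'⟩
      exact ⟨v, w', hv, hw', sv, sw', nv, nw', (h.trans _ _ _
        (inner hw hv' sw sv' (nw.trans nv'.symm))).trans _ _ _ h'⟩)
    (by
      intro P hP hP₀
      obtain ⟨c1, c2, c3, c4⟩ := hc P hP
      obtain ⟨cX, cY⟩ := (node_iff (cK P) P).1 c2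
      have cne : c P ≠ 1 := by rintro e; rw [e, node_one] at c2; exact hP₀ c2.symm
      have edge (i : ℕ) (hi : x (c P) = i) (hi' : i = 2 * k ∨ i = 2 * k + 1)
          (Q R : ZMod L × ZMod L)
          (hQ : (swap (κ 0) (κ i) * c P) (ι Q.1) = X ∧ (swap (κ 0) (κ i) * c P) (ι Q.2) = Y)
          (hR : (b i * c P) (ι R.1) = X ∧ (b i * c P) (ι R.2) = Y) :
          ∃ v w, v ∈ permsOn K ∧ w ∈ permsOn K ∧ Perm.sign v = -1 ∧ Perm.sign w = -1 ∧
            node v = Q ∧ node w = R ∧ Relation.EqvGen (ColourEdge κ b L x) v w := by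
        obtain ⟨b1, b2, b3⟩ := hb i hi'
        have m1 : swap (κ 0) (κ i) * c P ∈ permsOn K :=
          mul_mem (swap_mem_permsOn (mK (by omega)) (mK (by omega))) (cK P)
        have m2 : b i * c P ∈ permsOn K := by
          refine mul_mem (permsOn_mono (Set.image_mono fun j hj => ?_) b3) (cK P)
          have hj' : j < 2 * k ∨ j = i := hj
          exact Set.mem_Iio.2 (by omega)
        refine ⟨_, _, m1, m2, ?_, ?_, (node_iff m1 Q).2 hQ, (node_iff m2 R).2 hR,
          Relation.EqvGen.rel _ _ ⟨c P, cK P, c1, cne, by rw [hi], by rw [hi]⟩⟩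
        · rw [Perm.sign_mul, c1, Perm.sign_swap (κne (by omega) (by omega) (by omega)), mul_one]
        · rw [Perm.sign_mul, c1, b1, mul_one]
      have bfix (i j : ℕ) (hi : i = 2 * k ∨ i = 2 * k + 1) (hj : j = 2 * k ∨ j = 2 * k + 1)
          (hij : j ≠ i) : b i (κ j) = κ j := by
        refine (hb i hi).2.2 _ ?_
        rintro ⟨t, ht, e⟩
        have ht' : t < 2 * k ∨ t = i := ht
        exact κne (by omega) (by omega) (by omega) e
      have X0 : X ≠ κ 0 := κne (by omega) (by omega) (by omega)
      have Y0 : Y ≠ κ 0 := κne (by omega) (by omega) (by omega)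
      constructor
      · intro h
        have hi : x (c P) = 2 * k := by simp only [x, c2, if_true, if_neg h]
        have bX : b (2 * k) (κ (2 * k - 1)) = X := (hb _ (Or.inl rfl)).2.1
        have bY : b (2 * k) Y = Y := bfix _ _ (Or.inl rfl) (Or.inr rfl) (by omega)
        have aX : swap (κ 0) (κ (2 * k)) (κ 0) = X := swap_apply_left _ _
        have aY : swap (κ 0) (κ (2 * k)) Y = Y := swap_apply_of_ne_of_ne Y0 XY.symm
        rcases c4 hP₀ with ⟨h1, h2⟩ | ⟨h1, h2⟩
        · apply edge _ hi (Or.inl rfl) <;>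
            simp only [Perm.mul_apply, h1, h2, cY, bX, bY, aX, aY, and_self]
        -- Here $\kappa_0$ and $\kappa_{2k-1}$ stand in the other order, so the edge is read
        -- backwards.
        · obtain ⟨v, w, hv, hw, sv, sw, nv, nw, h⟩ :=
            edge _ hi (Or.inl rfl) ((joined P).2, P.2) ((joined P).1, P.2)
            (by simp only [Perm.mul_apply, h2, cY, aX, aY, and_self])
            (by simp only [Perm.mul_apply, h1, cY, bX, bY, and_self])
          exact ⟨w, v, hw, hv, sw, sv, nw, nv, h.symm⟩
      · intro h
        have hi : x (c P) = 2 * k + 1 := by simp only [x, c2, if_true, if_pos h]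
        have bY : b (2 * k + 1) (κ (2 * k - 1)) = Y := (hb _ (Or.inr rfl)).2.1
        have bX : b (2 * k + 1) X = X := bfix _ _ (Or.inr rfl) (Or.inl rfl) (by omega)
        have aY : swap (κ 0) (κ (2 * k + 1)) (κ 0) = Y := swap_apply_left _ _
        have aX : swap (κ 0) (κ (2 * k + 1)) X = X := swap_apply_of_ne_of_ne X0 XY
        rcases c4 hP₀ with ⟨h1, h2⟩ | ⟨h1, h2⟩
        · apply edge _ hi (Or.inr rfl) <;>
            simp only [Perm.mul_apply, h1, h2, cX, bX, bY, aX, aY, and_self]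
        · obtain ⟨v, w, hv, hw, sv, sw, nv, nw, h⟩ :=
            edge _ hi (Or.inr rfl) (P.1, (joined P).2) (P.1, (joined P).1)
            (by simp only [Perm.mul_apply, h2, cX, aX, aY, and_self])
            (by simp only [Perm.mul_apply, h1, cX, bX, bY, and_self])
          exact ⟨w, v, hw, hv, sw, sv, nw, nv, h.symm⟩)
    (node_ne hv) (node_ne hw)
  exact ((inner hv hv' sv sv' nv.symm).trans _ _ _ hvw).trans _ _ _ (inner hw' hw sw' sw nw)

theorem connectable {J : ℕ} (hJ : 1 ≤ J) (hκ : Set.InjOn κ (Set.Iio (2 * J)))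
    (hb : ∀ k i, 1 ≤ k → k < J → i = 2 * k ∨ i = 2 * k + 1 → Perm.sign (b i) = -1 ∧
      b i (κ (2 * k - 1)) = κ i ∧ b i ∈ permsOn (κ '' (Set.Iio (2 * k) ∪ {i}))) :
    Connectable κ b (2 * J) := by
  induction J, hJ using Nat.le_induction with
  | base => exact connectable_two hκ
  | succ k hk ih =>
    refine Connectable.add_two hk hκ (fun i hi => hb k i hk (by omega) hi) ?_
    exact ih (hκ.mono (Set.Iio_subset_Iio (by omega))) fun k' i h1 h2 => hb k' i h1 (by omega)

end perms

end RankModulation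

namespace RankModulation

open Equiv

variable {n : ℕ}

/-! ### The two chains that are joined through a linkage -/

theorem nearlySpanningTree_subset {m : ℕ} (hm : 2 ≤ m) {n : ℕ} (hmn : m ≤ n) :
    nearlySpanningTree m ⊆ nearlySpanningTree n := by
  induction n, hmn using Nat.le_induction with
  | base => exact List.Subset.refl _
  | succ n hn ih =>
    obtain ⟨k, rfl⟩ : ∃ k, n = k + 2 := ⟨n - 2, by omega⟩
    refine List.Subset.trans ih fun e he => ?_
    rw [nearlySpanningTree]
    simp only [List.mem_append, he, true_or]

theorem two_three_mem {j x : ℕ} (hj : 3 ≤ j) (hjn : j ≤ n) (hx : x = 2 * j ∨ x = 2 * j + 1) :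
    (2, 3, x) ∈ nearlySpanningTree n := by
  refine nearlySpanningTree_subset (by omega) hjn ?_
  obtain ⟨k, rfl⟩ : ∃ k, j = k + 3 := ⟨j - 3, by omega⟩
  rw [nearlySpanningTree]
  simp only [List.mem_append, List.mem_map, List.mem_range'_1]
  rcases hx with rfl | rfl
  · exact Or.inl (Or.inl (Or.inr ⟨2, by omega, rfl⟩))
  · exact Or.inl (Or.inr ⟨2, by omega, rfl⟩)

theorem one_last_mem {j x : ℕ} (hj : 3 ≤ j) (hjn : j ≤ n) (hx : x = 2 * j ∨ x = 2 * j + 1) :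
    (1, x, 2 * j - 1) ∈ nearlySpanningTree n ∧ (1, 2 * j, 2 * j + 1) ∈ nearlySpanningTree n := by
  refine ⟨nearlySpanningTree_subset (by omega) hjn ?_,
    nearlySpanningTree_subset (by omega) hjn ?_⟩ <;>
  obtain ⟨k, rfl⟩ : ∃ k, j = k + 3 := ⟨j - 3, by omega⟩
  all_goals
    rw [nearlySpanningTree]
    refine List.mem_append_right _ ?_
  · rcases hx with rfl | rfl <;> simp
  · simp

theorem one_two_mem {z : ℕ} (hn : 2 ≤ n) (hz : z = 3 ∨ z = 5) :
    (1, 2, z) ∈ nearlySpanningTree n := by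
  refine nearlySpanningTree_subset le_rfl hn ?_
  rcases hz with rfl | rfl <;> simp [nearlySpanningTree]

/-- The relabelling that takes the linkage `[α,x,2,1]` to the necklace in the class `[1,2]` of the
chain that contains `[α,1,x,2]`. -/
def linkFst (Φ : ℕ × ℕ → OddPerm n) (x : ℕ) : OddPerm n :=
  Φ (x, 2) * cyc (lab n x) (lab n 1) (lab n 2)

/-- The relabelling that takes the linkage `[α,x,2,1]` to the necklace in the class `[1,2]` of the
chain that contains `[α,2,1,x]`. -/
def linkSnd (Φ : ℕ × ℕ → OddPerm n) (x : ℕ) : OddPerm n :=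
  Φ (1, x) * (cyc (lab n x) (lab n 1) (lab n 2) * cyc (lab n x) (lab n 1) (lab n 2))

theorem root_linkFst (hn : 3 ≤ n) (Φ : ℕ × ℕ → OddPerm n) {x : ℕ} {ω : OddPerm n}
    (h : lastThree ω = (x, 2, 1)) : root Φ (ω * lastRot n) = linkFst Φ x * ω := by
  rw [root, lastThree_mul_lastRot hn h, mul_lastRot_of_lastThree h, linkFst, mul_assoc]

theorem root_linkSnd (hn : 3 ≤ n) (Φ : ℕ × ℕ → OddPerm n) {x : ℕ} (h3 : 3 ≤ x) (hx : x ≤ 2 * n + 1)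
    {ω : OddPerm n} (h : lastThree ω = (x, 2, 1)) :
    root Φ (ω * lastRot n * lastRot n) = linkSnd Φ x * ω := by
  have h1 := lastThree_mul_lastRot hn h
  have n1 : lab n x ≠ lab n 1 := lab_ne (by omega) (by omega) hx (by omega) (by omega)
  have n2 : lab n x ≠ lab n 2 := lab_ne (by omega) (by omega) hx (by omega) (by omega)
  have n3 : lab n 1 ≠ lab n 2 := lab_ne (by omega) (by omega) (by omega) (by omega) (by omega)
  rw [root, lastThree_mul_lastRot hn h1, mul_lastRot_of_lastThree h1, mul_lastRot_of_lastThree h,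
    linkSnd, cyc_rotate n1 n2 n3]
  simp only [mul_assoc]

/-- The triples $\langle1,2,3\rangle$ and $\langle2,3,x\rangle$ both compute `Φ (2, 3)`, which
determines `Φ (x, 2)`. The product of 3-cycles then collapses to a transposition. -/
theorem IsRelabelling.linkFst_eq (hn : 3 ≤ n) {Φ : ℕ × ℕ → OddPerm n} (hΦ : IsRelabelling n Φ)
    {x : ℕ} (h6 : 6 ≤ x) (hx : x ≤ 2 * n + 1) :
    linkFst Φ x * swap (lab n 1) (lab n 2) = swap (lab n 3) (lab n x) := by
  have e1 := hΦ.compatible _ (one_two_mem (by omega) (Or.inl rfl)) 2 3 1 (by simp [Matches])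
  have e2 := hΦ.compatible _ (two_three_mem (j := x / 2) (x := x) (by omega) (by omega) (by omega))
    2 3 x (by simp [Matches])
  rw [hΦ.one, one_mul] at e1
  rw [← e1, ← eq_mul_inv_iff_mul_eq] at e2
  rw [linkFst, e2]
  have n1 : lab n x ≠ lab n 1 := lab_ne (by omega) (by omega) hx (by omega) (by omega)
  have n3 : lab n x ≠ lab n 3 := lab_ne (by omega) (by omega) hx (by omega) (by omega)
  have n4 : lab n 1 ≠ lab n 3 := lab_ne (by omega) (by omega) (by omega) (by omega) (by omega)
  simp only [cyc, mul_inv_rev, swap_inv]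
  have (a b c d : OddPerm n) (s t : Fin (2 * n + 1)) :
      a * swap s t * (swap s t * b) * (c * d) * d⁻¹ = a * b * c := by
    have : swap s t * (swap s t * b) = b := by rw [← mul_assoc, swap_mul_self, one_mul]
    rw [mul_assoc a, this]; group
  have h := this (swap (lab n 1) (lab n 3)) (swap (lab n x) (lab n 3)) (swap (lab n x) (lab n 1))
    (swap (lab n 1) (lab n 2)) (lab n 3) (lab n 2)
  rw [swap_inv] at h
  rw [h]
  ext l
  simp only [Perm.mul_apply, swap_apply_def]
  split_ifs <;> simp_all

theorem IsRelabelling.last_one (hn : 3 ≤ n) {Φ : ℕ × ℕ → OddPerm n} (hΦ : IsRelabelling n Φ)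
    {j x l : ℕ} (hj : 3 ≤ j) (hjn : j ≤ n) (hx : x = 2 * j ∨ x = 2 * j + 1) (hl : 1 ≤ l)
    (hl' : l ≤ 2 * n + 1) (hl1 : l ≠ 1) (hlx : l ≠ x) (hlj : l ≠ 2 * j - 1) :
    Φ (1, x) (lab n l) = Φ (2 * j - 1, 1) (lab n l) := by
  have e := hΦ.compatible _ (one_last_mem hj hjn hx).1 1 x (2 * j - 1) (by simp [Matches])
  rw [← e, Perm.mul_apply, cyc_apply_of_ne] <;>
    exact lab_ne (by omega) (by omega) (by omega) (by omega) (by omega)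

/-- The classes $[1,2]$ and $[2j+1,1]$ are linked by $\langle1,2,5\rangle$ and the triples
$\langle1,2i,2i-1\rangle$, $\langle1,2i,2i+1\rangle$ with $3\le i\le j$. None of them contains 4 or
a label above $2j+1$. -/
theorem IsRelabelling.last_fixes (hn : 3 ≤ n) {Φ : ℕ × ℕ → OddPerm n} (hΦ : IsRelabelling n Φ)
    {j : ℕ} (hj : 2 ≤ j) : j ≤ n → ∀ l, l = 4 ∨ 2 * j + 2 ≤ l → l ≤ 2 * n + 1 →
    Φ (2 * j + 1, 1) (lab n l) = lab n l := by
  induction j, hj using Nat.le_induction with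
  | base =>
    intro _ l hl hl'
    have e := hΦ.compatible _ (one_two_mem (by omega) (Or.inr rfl)) 1 2 5 (by simp [Matches])
    rw [hΦ.one] at e
    have e' := DFunLike.congr_fun e (lab n l)
    rw [Perm.mul_apply, cyc_apply_of_ne] at e'
    · exact e'
    all_goals exact lab_ne (by omega) (by omega) (by omega) (by omega) (by omega)
  | succ j hj ih =>
    intro hjn l hl hl'
    have e := hΦ.compatible _ (one_last_mem (j := j + 1) (by omega) hjn (Or.inl rfl)).2
      1 (2 * (j + 1)) (2 * (j + 1) + 1) (by simp [Matches])
    have e' := DFunLike.congr_fun e (lab n l)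
    rw [Perm.mul_apply, cyc_apply_of_ne] at e'
    · rw [e', hΦ.last_one hn (j := j + 1) (by omega) hjn (Or.inl rfl) (by omega) hl' (by omega)
        (by omega) (by omega)]
      exact ih (by omega) l (by omega) hl'
    all_goals exact lab_ne (by omega) (by omega) (by omega) (by omega) (by omega)

/-- With `linkSnd_apply_last` and `sign_linkSnd` this supplies what `Connectable.add_two` asks of
`b`. -/
theorem IsRelabelling.linkSnd_apply (hn : 3 ≤ n) {Φ : ℕ × ℕ → OddPerm n} (hΦ : IsRelabelling n Φ)
    {j x l : ℕ} (hj : 3 ≤ j) (hjn : j ≤ n) (hx : x = 2 * j ∨ x = 2 * j + 1)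
    (hl : l = 1 ∨ l = 2 ∨ l = 4 ∨ (2 * j ≤ l ∧ l ≤ 2 * n + 1 ∧ l ≠ x)) :
    (linkSnd Φ x * swap (lab n 1) (lab n 2)) (lab n l) = lab n l := by
  have n1 : lab n x ≠ lab n 1 := lab_ne (by omega) (by omega) (by omega) (by omega) (by omega)
  have n2 : lab n x ≠ lab n 2 := lab_ne (by omega) (by omega) (by omega) (by omega) (by omega)
  have n3 : lab n 1 ≠ lab n 2 := lab_ne (by omega) (by omega) (by omega) (by omega) (by omega)
  have hv : ((1, x) : ℕ × ℕ) ∈ visited n := by simp only [visited, Set.mem_ofPred_eq]; omega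
  obtain ⟨r1, r2, -⟩ := hΦ.relabels _ hv
  simp only [linkSnd, Perm.mul_apply]
  rcases hl with rfl | rfl | hl
  · rw [swap_apply_left, cyc_apply_right, cyc_apply_left n1 n2, r1]
  · rw [swap_apply_right, cyc_apply_mid n2 n3, cyc_apply_right, r2]
  · have m1 : lab n l ≠ lab n 1 := lab_ne (by omega) (by omega) (by omega) (by omega) (by omega)
    have m2 : lab n l ≠ lab n 2 := lab_ne (by omega) (by omega) (by omega) (by omega) (by omega)
    have m3 : lab n l ≠ lab n x := lab_ne (by omega) (by omega) (by omega) (by omega) (by omega)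
    rw [swap_apply_of_ne_of_ne m1 m2, cyc_apply_of_ne m3 m1 m2, cyc_apply_of_ne m3 m1 m2,
      hΦ.last_one hn hj hjn hx (by omega) (by omega) (by omega) (by omega) (by omega)]
    have := hΦ.last_fixes hn (j := j - 1) (by omega) (by omega) l (by omega) (by omega)
    rwa [show 2 * (j - 1) + 1 = 2 * j - 1 by omega] at this

theorem IsRelabelling.linkSnd_apply_last (hn : 3 ≤ n) {Φ : ℕ × ℕ → OddPerm n}
    (hΦ : IsRelabelling n Φ) {j x : ℕ} (hj : 3 ≤ j) (hjn : j ≤ n)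
    (hx : x = 2 * j ∨ x = 2 * j + 1) :
    (linkSnd Φ x * swap (lab n 1) (lab n 2)) (lab n (2 * j - 1)) = lab n x := by
  have e := hΦ.compatible _ (one_last_mem hj hjn hx).1 1 x (2 * j - 1) (by simp [Matches])
  have ne {k l : ℕ} (h : k ≠ l) (h1 : 1 ≤ k ∧ 1 ≤ l) (h2 : k ≤ 2 * n + 1 ∧ l ≤ 2 * n + 1) :
    lab n k ≠ lab n l := lab_ne h h1.1 h2.1 h1.2 h2.2
  have m1 : lab n (2 * j - 1) ≠ lab n 1 := ne (by omega) (by omega) (by omega)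
  have m2 : lab n (2 * j - 1) ≠ lab n 2 := ne (by omega) (by omega) (by omega)
  have m3 : lab n (2 * j - 1) ≠ lab n x := ne (by omega) (by omega) (by omega)
  simp only [linkSnd, Perm.mul_apply]
  rw [swap_apply_of_ne_of_ne m1 m2, cyc_apply_of_ne m3 m1 m2, cyc_apply_of_ne m3 m1 m2, ← e,
    Perm.mul_apply, cyc_apply_left m3 m1]
  have := hΦ.last_fixes hn (j := j - 1) (by omega) (by omega) x (by omega) (by omega)
  rwa [show 2 * (j - 1) + 1 = 2 * j - 1 by omega] at this

theorem IsRelabelling.sign_linkSnd (hn : 3 ≤ n) {Φ : ℕ × ℕ → OddPerm n} (hΦ : IsRelabelling n Φ)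
    {x : ℕ} (h3 : 3 ≤ x) (hx : x ≤ 2 * n + 1) :
    Perm.sign (linkSnd Φ x * swap (lab n 1) (lab n 2)) = -1 := by
  have n1 : lab n x ≠ lab n 1 := lab_ne (by omega) (by omega) (by omega) (by omega) (by omega)
  have n3 : lab n 1 ≠ lab n 2 := lab_ne (by omega) (by omega) (by omega) (by omega) (by omega)
  have hv : ((1, x) : ℕ × ℕ) ∈ visited n := by simp only [visited, Set.mem_ofPred_eq]; omega
  obtain ⟨-, -, r⟩ := hΦ.relabels _ hv
  simp only [linkSnd, Perm.sign_mul, r, sign_cyc n1 n3, Perm.sign_swap n3, one_mul]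

/-- The labels other than `1`, `2` and `4`. -/
def freeLabel (n i : ℕ) : Fin (2 * n + 1) := if i = 0 then lab n 3 else lab n (i + 4)

theorem freeLabel_of_pos {i : ℕ} (hi : 1 ≤ i) : freeLabel n i = lab n (i + 4) :=
  if_neg (by omega)

theorem freeLabel_injOn (hn : 3 ≤ n) : Set.InjOn (freeLabel n) (Set.Iio (2 * (n - 1))) := by
  intro i hi j hj h
  simp only [Set.mem_Iio] at hi hj
  simp only [freeLabel] at h
  by_contra hij
  split_ifs at h with h1 h2 h2
  · omega
  all_goals exact lab_ne (by omega) (by omega) (by omega) (by omega) (by omega) h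

theorem exists_freeLabel {k l : ℕ} (hl : 1 ≤ l) (hl1 : l ≠ 1) (hl2 : l ≠ 2) (hl4 : l ≠ 4)
    (hk : l < k + 4) (h3 : 1 ≤ k) : ∃ i < k, freeLabel n i = lab n l := by
  by_cases h : l = 3
  · exact ⟨0, by omega, by simp [freeLabel, h]⟩
  · exact ⟨l - 4, by omega, by rw [freeLabel_of_pos (by omega)]; congr 1; omega⟩

theorem IsRelabelling.linkSnd_mem_permsOn (hn : 3 ≤ n) {Φ : ℕ × ℕ → OddPerm n}
    (hΦ : IsRelabelling n Φ) {k i : ℕ} (hk : 1 ≤ k) (hkn : k < n - 1)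
    (hi : i = 2 * k ∨ i = 2 * k + 1) : linkSnd Φ (i + 4) * swap (lab n 1) (lab n 2) ∈
      permsOn (freeLabel n '' (Set.Iio (2 * k) ∪ {i})) := by
  intro l hl
  rw [← lab_val_add_one l] at hl ⊢
  have hlt := l.isLt
  refine hΦ.linkSnd_apply hn (j := k + 2) (by omega) (by omega) (by omega) ?_
  by_contra hc
  apply hl
  by_cases h : l.val + 1 = i + 4
  · exact ⟨i, Or.inr rfl, by rw [freeLabel_of_pos (by omega), h]⟩
  · obtain ⟨t, ht, e⟩ := exists_freeLabel (n := n) (k := 2 * k) (l := l.val + 1) (by omega)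
      (by omega) (by omega) (by omega) (by omega) (by omega)
    exact ⟨t, Or.inl ht, e⟩

/-- The indices `2 * k` and `2 * k + 1` stand for the labels $2j$ and $2j+1$ with $j=k+2$, and `2 *
k - 1` for $2j-1$. -/
theorem IsRelabelling.connectable (hn : 3 ≤ n) {Φ : ℕ × ℕ → OddPerm n} (hΦ : IsRelabelling n Φ) :
    Connectable (freeLabel n) (fun i => linkSnd Φ (i + 4) * swap (lab n 1) (lab n 2))
      (2 * (n - 1)) := by
  refine RankModulation.connectable (by omega) (freeLabel_injOn hn) ?_
  intro k i hk hkn hi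
  refine ⟨hΦ.sign_linkSnd hn (by omega) (by omega), ?_, hΦ.linkSnd_mem_permsOn hn hk hkn hi⟩
  rw [freeLabel_of_pos (by omega), freeLabel_of_pos (by omega)]
  have := hΦ.linkSnd_apply_last hn (j := k + 2) (x := i + 4) (by omega) (by omega) (by omega)
  rwa [show 2 * (k + 2) - 1 = 2 * k - 1 + 4 by omega] at this

end RankModulation

namespace RankModulation

open Equiv

variable {n : ℕ}

/-! ### The spanning tree -/

/-- The permutations of the labels other than `1`, `2` and `4`. -/
def freePerms (n : ℕ) : Subgroup (OddPerm n) := permsOn (freeLabel n '' Set.Iio (2 * (n - 1)))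

theorem freePerms_apply (hn : 3 ≤ n) {u : OddPerm n} (hu : u ∈ freePerms n) {l : ℕ}
    (hl : l = 1 ∨ l = 2 ∨ l = 4) : u (lab n l) = lab n l := by
  refine hu _ ?_
  rintro ⟨i, hi, e⟩
  simp only [Set.mem_Iio] at hi
  simp only [freeLabel] at e
  split_ifs at e
  · exact lab_ne (by omega) (by omega) (by omega) (by omega) (by omega) e
  · exact lab_ne (by omega) (by omega) (by omega) (by omega) (by omega) e

theorem lastThree_eq_iff_lab {p : OddPerm n} {x y z : ℕ}
    (h1 : 1 ≤ x ∧ 1 ≤ y ∧ 1 ≤ z) (h2 : x ≤ 2 * n + 1 ∧ y ≤ 2 * n + 1 ∧ z ≤ 2 * n + 1) :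
    lastThree p = (x, y, z) ↔
      p (posA n) = lab n x ∧ p (posB n) = lab n y ∧ p (posC n) = lab n z := by
  have key (i : Fin (2 * n + 1)) {l : ℕ} (hl : 1 ≤ l) (hl' : l ≤ 2 * n + 1) :
      i.val + 1 = l ↔ i = lab n l := by
    constructor
    · rintro rfl; rw [lab_val_add_one]
    · rintro rfl; rw [val_lab hl hl']
  rw [lastThree_eq_iff, key _ h1.1 h2.1, key _ h1.2.1 h2.2.1, key _ h1.2.2 h2.2.2]

theorem lastThree_freePerms_mul (hn : 3 ≤ n) {u h : OddPerm n} (hu : u ∈ freePerms n)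
    (hh : lastThree h = (4, 1, 2)) : lastThree (u * h) = (4, 1, 2) := by
  rw [lastThree_eq_iff_lab (by omega) (by omega)] at hh ⊢
  obtain ⟨h1, h2, h3⟩ := hh
  simp only [Perm.mul_apply, h1, h2, h3]
  exact ⟨freePerms_apply hn hu (by simp), freePerms_apply hn hu (by simp),
    freePerms_apply hn hu (by simp)⟩

theorem mul_inv_mem_freePerms (hn : 3 ≤ n) {p h : OddPerm n} (hp : lastThree p = (4, 1, 2))
    (hh : lastThree h = (4, 1, 2)) : p * h⁻¹ ∈ freePerms n := by
  rw [lastThree_eq_iff_lab (by omega) (by omega)] at hp hh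
  obtain ⟨h1, h2, h3⟩ := hh
  obtain ⟨p1, p2, p3⟩ := hp
  intro l hl
  rw [Perm.mul_apply]
  by_cases e4 : l = lab n 4
  · rw [e4, Perm.inv_eq_iff_eq.2 h1.symm, p1]
  by_cases e1 : l = lab n 1
  · rw [e1, Perm.inv_eq_iff_eq.2 h2.symm, p2]
  by_cases e2 : l = lab n 2
  · rw [e2, Perm.inv_eq_iff_eq.2 h3.symm, p3]
  refine absurd ?_ hl
  rw [← lab_val_add_one l] at e1 e2 e4 ⊢
  have hlt := l.isLt
  obtain ⟨i, hi, e⟩ := exists_freeLabel (n := n) (k := 2 * (n - 1)) (l := l.val + 1) (by omega)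
    (fun e => e1 (by rw [e])) (fun e => e2 (by rw [e])) (fun e => e4 (by rw [e])) (by omega)
    (by omega)
  exact ⟨i, hi, e⟩

theorem lastThree_swap_mul (hn : 3 ≤ n) {p : OddPerm n} :
    lastThree (swap (lab n 1) (lab n 2) * p) = (4, 1, 2) ↔ lastThree p = (4, 2, 1) := by
  rw [lastThree_eq_iff_lab (by omega) (by omega), lastThree_eq_iff_lab (by omega) (by omega)]
  have n1 : lab n 4 ≠ lab n 1 := lab_ne (by omega) (by omega) (by omega) (by omega) (by omega)
  have n2 : lab n 4 ≠ lab n 2 := lab_ne (by omega) (by omega) (by omega) (by omega) (by omega)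
  have key (i j : Fin (2 * n + 1)) : swap (lab n 1) (lab n 2) i = j ↔
      i = swap (lab n 1) (lab n 2) j := by
    constructor <;> rintro rfl <;> simp
  simp only [Perm.mul_apply, key, swap_apply_left, swap_apply_right, swap_apply_of_ne_of_ne n1 n2]

theorem exists_odd_lastThree (hn : 3 ≤ n) :
    ∃ h : OddPerm n, Perm.sign h = -1 ∧ lastThree h = (4, 1, 2) := by
  have ne {k l : ℕ} (h : k ≠ l) (h1 : 1 ≤ k ∧ 1 ≤ l) (h2 : k ≤ 7 ∧ l ≤ 7) :
    lab n k ≠ lab n l := lab_ne h h1.1 (by omega) h1.2 (by omega)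
  have hB : posB n ≠ 0 := by simp only [posB, ne_eq, Fin.ext_iff, Fin.val_zero]; omega
  have hC : posC n ≠ 0 := by simp only [posC, ne_eq, Fin.ext_iff, Fin.val_zero]; omega
  obtain ⟨u, -, hs, h1, h2, h3⟩ := exists_even_permsOn (K := Set.univ) (p := posA n) (q := posB n)
    (r := posC n) (s := (0 : Fin (2 * n + 1))) (X := lab n 4) (Y := lab n 1) (A := lab n 2)
    (B := lab n 3) trivial trivial trivial trivial trivial trivial trivial trivial
    (posA_ne_posB hn) (posA_ne_posC hn) (posA_val_ne_zero hn) (posB_ne_posC hn) hB hC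
    (ne (by omega) (by omega) (by omega)) (ne (by omega) (by omega) (by omega))
    (ne (by omega) (by omega) (by omega)) (ne (by omega) (by omega) (by omega))
    (ne (by omega) (by omega) (by omega)) (ne (by omega) (by omega) (by omega))
  have key (a b : ℕ) (hab : a ≠ b) (ha : 2 ≤ a ∧ a ≤ 7 ∧ a ≠ 4) (hb : 2 ≤ b ∧ b ≤ 7 ∧ b ≠ 4)
      (h : swap (lab n a) (lab n b) (u (posC n)) = lab n 2) :
      ∃ h : OddPerm n, Perm.sign h = -1 ∧ lastThree h = (4, 1, 2) := by
    refine ⟨swap (lab n a) (lab n b) * u, ?_, ?_⟩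
    · rw [Perm.sign_mul, hs, Perm.sign_swap (ne hab (by omega) (by omega)), mul_one]
    · rw [lastThree_eq_iff_lab (by omega) (by omega)]
      simp only [Perm.mul_apply, h1, h2, h, and_true]
      exact ⟨swap_apply_of_ne_of_ne (ne (by omega) (by omega) (by omega))
        (ne (by omega) (by omega) (by omega)), swap_apply_of_ne_of_ne
        (ne (by omega) (by omega) (by omega)) (ne (by omega) (by omega) (by omega))⟩
  rcases h3 with ⟨h3, -⟩ | ⟨h3, -⟩
  · refine key 5 6 (by omega) (by omega) (by omega) ?_
    rw [h3]
    exact swap_apply_of_ne_of_ne (ne (by omega) (by omega) (by omega))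
      (ne (by omega) (by omega) (by omega))
  · refine key 2 3 (by omega) (by omega) (by omega) ?_
    rw [h3, swap_apply_right]

theorem mem_chainOf_of_neck (hn : 3 ≤ n) {π p : OddPerm n} (hπ : (lastThree π).2 = (1, 2))
    (hp : (lastThree p).2 = (1, 2)) : p ∈ chainOf π ↔ Neck π p := by
  obtain ⟨Φ, hΦ⟩ := exists_isRelabelling hn
  rw [mem_chainOf hn hΦ hπ, root, hp, hΦ.one, one_mul, and_iff_right]
  simp only [visited, Set.mem_ofPred_eq]; omega

/-- `ω e` is the member of the linkage of `e` at which the merging takes place, and `ω₀` is on the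
only linkage that labels no edge. -/
theorem exists_spanningTree (hn : 3 ≤ n) : ∃ (T : SimpleGraph (Chain n))
    (label : T.edgeSet → Linkage n) (ω : T.edgeSet → OddPerm n) (ω₀ : OddPerm n),
    IsDistinctlyLabelledSpanningTree T label ∧ InClass ω₀ 2 1 ∧
    (∀ e, InClass (ω e) 2 1 ∧ (label e).1 = necklace (ω e)) ∧
    (∀ e, ∃ C D : Chain n, e.1 = s(C, D) ∧ ω e * lastRot n ∈ C.1 ∧
      ω e * lastRot n * lastRot n ∈ D.1) ∧
    (∀ e e', Neck (ω e) (ω e') → e = e') ∧ (∀ e, ¬ Neck ω₀ (ω e)) ∧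
    ∀ q, InClass q 2 1 → Neck ω₀ q ∨ ∃ e, Neck (ω e) q := by
  classical
  obtain ⟨Φ, hΦ⟩ := exists_isRelabelling hn
  obtain ⟨h, hsign, hh⟩ := exists_odd_lastThree hn
  obtain ⟨x, hx, hconn⟩ := hΦ.connectable hn
  set b : ℕ → OddPerm n := fun i => linkSnd Φ (i + 4) * swap (lab n 1) (lab n 2) with hb
  have n12 : lab n 1 ≠ lab n 2 := lab_ne (by omega) (by omega) (by omega) (by omega) (by omega)
  let V : Set (OddPerm n) := {v | v ∈ freePerms n ∧ Perm.sign v = -1}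
  let E : Set (OddPerm n) := {u | u ∈ freePerms n ∧ Perm.sign u = 1}
  let F : Set (OddPerm n) := {u | u ∈ freePerms n ∧ Perm.sign u = 1 ∧ u ≠ 1}
  have hVclass {v : OddPerm n} (hv : v ∈ V) : InClass (v * h) 1 2 := by
    refine ⟨?_, by rw [lastThree_freePerms_mul hn hv.1 hh]⟩
    rw [Perm.sign_mul, hsign, hv.2]; rfl
  have s01 : swap (freeLabel n 0) (freeLabel n 1) ∈ freePerms n :=
    swap_mem_permsOn ⟨0, Set.mem_Iio.2 (by omega), rfl⟩ ⟨1, Set.mem_Iio.2 (by omega), rfl⟩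
  have s01' : Perm.sign (swap (freeLabel n 0) (freeLabel n 1)) = -1 :=
    Perm.sign_swap fun e => by
      have := freeLabel_injOn hn (Set.mem_Iio.2 (by omega)) (Set.mem_Iio.2 (by omega)) e
      omega
  have hcard : Nat.card V = Nat.card F + 1 := by
    have h1 : Nat.card V = Nat.card E := Nat.card_congr
      { toFun := fun v => ⟨swap (freeLabel n 0) (freeLabel n 1) * v.1, mul_mem s01 v.2.1, by
          rw [Perm.sign_mul, s01', v.2.2]; rfl⟩
        invFun := fun v => ⟨swap (freeLabel n 0) (freeLabel n 1) * v.1, mul_mem s01 v.2.1, by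
          rw [Perm.sign_mul, s01', v.2.2]; rfl⟩
        left_inv := fun v => by simp
        right_inv := fun v => by simp }
    have h2 : E = insert 1 F := by
      ext u
      by_cases hu : u = 1
      · subst hu; simp [E, one_mem]
      · simp [E, F, hu]
    rw [h1, h2, Nat.card_coe_set_eq, Set.ncard_insert_of_notMem (fun e => e.2.2 rfl),
      Nat.card_coe_set_eq]
  let C₀ : Chain n := ⟨chainOf _, _, hVclass ⟨s01, s01'⟩, rfl⟩
  let ch : OddPerm n → Chain n := fun v =>
    if hv : v ∈ V then ⟨chainOf (v * h), _, hVclass hv, rfl⟩ else C₀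
  have ch_val {v : OddPerm n} (hv : v ∈ V) : (ch v).1 = chainOf (v * h) := by
    exact congrArg Subtype.val (dif_pos hv : ch v = _)
  have ch_bij : Function.Bijective (fun v : V => ch v.1) := by
    constructor
    · rintro ⟨v, hv⟩ ⟨w, hw⟩ e
      have e1 : chainOf (v * h) = chainOf (w * h) := by
        rw [← ch_val hv, ← ch_val hw]; exact congrArg Subtype.val e
      have e2 := (mem_chainOf_of_neck hn (hVclass hw).2 (hVclass hw).2).2 (Neck.refl _)
      rw [← e1, mem_chainOf_of_neck hn (hVclass hv).2 (hVclass hw).2] at e2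
      have e3 := e2.eq_of_lastThree hn (by
        rw [lastThree_freePerms_mul hn hv.1 hh, lastThree_freePerms_mul hn hw.1 hh])
      exact Subtype.ext (mul_right_cancel e3).symm
    · rintro ⟨c, π, hπ, rfl⟩
      obtain ⟨p, hp, hl⟩ := exists_neck_lastThree hn π hπ.2 (x := 4) (by omega) (by omega)
        (by omega) (by omega)
      have hv : p * h⁻¹ ∈ V := ⟨mul_inv_mem_freePerms hn hl hh, by
        rw [Perm.sign_mul, Perm.sign_inv, hsign, hp.sign, hπ.1]; rfl⟩
      refine ⟨⟨p * h⁻¹, hv⟩, Subtype.ext ?_⟩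
      simp only [ch_val hv, inv_mul_cancel_right]
      exact (chainOf_eq_of_neck hn hp).symm
  have : Finite (Chain n) := Finite.of_surjective _ ch_bij.2
  have hcardC : Nat.card (Chain n) = Nat.card F + 1 := by
    rw [← Nat.card_eq_of_bijective _ ch_bij, hcard]
  -- Exchanging the labels 1 and 2 turns the ending 4, 1, 2 into 4, 2, 1 and makes up for the odd
  -- sign of `h`.
  let word : OddPerm n → OddPerm n := fun u => swap (lab n 1) (lab n 2) * (u * h)
  have word_last {u : OddPerm n} (hu : u ∈ freePerms n) : lastThree (word u) = (4, 2, 1) := by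
    rw [← lastThree_swap_mul hn, swap_mul_self_mul]
    exact lastThree_freePerms_mul hn hu hh
  have word_sign {u : OddPerm n} (hu : Perm.sign u = 1) : Perm.sign (word u) = 1 := by
    simp only [word, Perm.sign_mul, Perm.sign_swap n12, hu, hsign]; rfl
  have word_inj {u v : OddPerm n} (hu : u ∈ freePerms n) (hv : v ∈ freePerms n)
      (huv : Neck (word u) (word v)) : u = v := by
    have := huv.eq_of_lastThree hn (by rw [word_last hu, word_last hv])
    exact (mul_right_cancel (mul_left_cancel this)).symm
  have word_surj {q : OddPerm n} (hq : InClass q 2 1) : ∃ u ∈ E, Neck (word u) q := by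
    obtain ⟨p, hp, hl⟩ := exists_neck_lastThree hn q hq.2 (x := 4) (by omega) (by omega)
      (by omega) (by omega)
    refine ⟨swap (lab n 1) (lab n 2) * p * h⁻¹, ⟨?_, ?_⟩, ?_⟩
    · exact mul_inv_mem_freePerms hn ((lastThree_swap_mul hn).2 hl) hh
    · rw [Perm.sign_mul, Perm.sign_mul, Perm.sign_inv, hsign, hp.sign, hq.1, Perm.sign_swap n12]
      rfl
    · simp only [word, inv_mul_cancel_right, swap_mul_self_mul]
      exact hp.symm
  have hω (u : F) : ∃ ω, Neck (word u.1) ω ∧ lastThree ω = (x u.1 + 4, 2, 1) := by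
    have := hx u.1 u.2.1 u.2.2.1 u.2.2.2
    exact exists_neck_lastThree hn _ (by rw [word_last u.2.1]) (by omega) (by omega) (by omega)
      (by omega)
  choose ω hωn hωl using hω
  let fst : F → OddPerm n := fun u => swap (freeLabel n 0) (freeLabel n (x u.1)) * u.1
  let snd : F → OddPerm n := fun u => b (x u.1) * u.1
  have hfst (u : F) : fst u ∈ V ∧ ω u * lastRot n ∈ (ch (fst u)).1 := by
    have := hx u.1 u.2.1 u.2.2.1 u.2.2.2
    have hV : fst u ∈ V := by
      refine ⟨mul_mem (swap_mem_permsOn ⟨0, Set.mem_Iio.2 (by omega), rfl⟩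
        ⟨_, Set.mem_Iio.2 this.2, rfl⟩) u.2.1, ?_⟩
      rw [Perm.sign_mul, u.2.2.1, Perm.sign_swap, mul_one]
      intro e
      have := freeLabel_injOn hn (Set.mem_Iio.2 (by omega)) (Set.mem_Iio.2 (by omega)) e
      omega
    refine ⟨hV, ?_⟩
    rw [ch_val hV, mem_chainOf hn hΦ (hVclass hV).2, lastThree_mul_lastRot hn (hωl u),
      root_linkFst hn Φ (hωl u)]
    constructor
    · simp only [visited, Set.mem_ofPred_eq]; omega
    · have e := hΦ.linkFst_eq hn (x := x u.1 + 4) (by omega) (by omega)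
      have e2 : fst u * h = linkFst Φ (x u.1 + 4) * word u.1 := by
        simp only [fst, word, ← mul_assoc, e, freeLabel_of_pos (show 1 ≤ x u.1 by omega)]
        rfl
      rw [e2]
      exact (hωn u).mul_left _
  have hsnd (u : F) : snd u ∈ V ∧ ω u * lastRot n * lastRot n ∈ (ch (snd u)).1 := by
    have hxu := hx u.1 u.2.1 u.2.2.1 u.2.2.2
    have hV : snd u ∈ V := by
      refine ⟨mul_mem ?_ u.2.1, ?_⟩
      · refine permsOn_mono (Set.image_mono ?_) (hΦ.linkSnd_mem_permsOn hn (k := x u.1 / 2)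
          (by omega) (by omega) (by omega))
        intro j hj
        have hj' : j < 2 * (x u.1 / 2) ∨ j = x u.1 := hj
        exact Set.mem_Iio.2 (by omega)
      · rw [Perm.sign_mul, u.2.2.1, hΦ.sign_linkSnd hn (by omega) (by omega), mul_one]
    refine ⟨hV, ?_⟩
    rw [ch_val hV, mem_chainOf hn hΦ (hVclass hV).2,
      lastThree_mul_lastRot hn (lastThree_mul_lastRot hn (hωl u)),
      root_linkSnd hn Φ (by omega) (by omega) (hωl u)]
    constructor
    · simp only [visited, Set.mem_ofPred_eq]; omega
    · have e2 : snd u * h = linkSnd Φ (x u.1 + 4) * word u.1 := by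
        simp only [snd, word, hb, ← mul_assoc]
      rw [e2]
      exact (hωn u).mul_left _
  let ε : F → Sym2 (Chain n) := fun u => s(ch (fst u), ch (snd u))
  let T : SimpleGraph (Chain n) := SimpleGraph.fromEdgeSet (Set.range ε)
  have hreach {v w : OddPerm n} (hvw : Relation.EqvGen (ColourEdge (freeLabel n) b
      (2 * (n - 1)) x) v w) : T.Reachable (ch v) (ch w) := by
    induction hvw with
    | rel v w hvw =>
      obtain ⟨u, hu, su, u1, rfl, rfl⟩ := hvw
      -- Loops and repeated edges are not excluded at this point; the count below shows that neither
      -- occurs.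
      by_cases e : ch (swap (freeLabel n 0) (freeLabel n (x u)) * u) = ch (b (x u) * u)
      · rw [e]
      · refine SimpleGraph.Adj.reachable ?_
        rw [SimpleGraph.fromEdgeSet_adj]
        exact ⟨⟨⟨u, hu, su, u1⟩, rfl⟩, e⟩
    | refl v => exact SimpleGraph.Reachable.refl _
    | symm v w _ ih => exact ih.symm
    | trans _ _ _ _ _ ih1 ih2 => exact ih1.trans ih2
  have hTconn : T.Connected := by
    have : Nonempty (Chain n) := ⟨C₀⟩
    refine SimpleGraph.Connected.mk fun C D => ?_
    obtain ⟨⟨v, hv⟩, rfl⟩ := ch_bij.2 C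
    obtain ⟨⟨w, hw⟩, rfl⟩ := ch_bij.2 D
    exact hreach (hconn v hv.1 w hw.1 hv.2 hw.2)
  have hsub : T.edgeSet ⊆ Set.range ε := by
    rw [SimpleGraph.edgeSet_fromEdgeSet]; exact Set.sdiff_subset
  choose col hcol using fun e : T.edgeSet => hsub e.2
  have col_inj : Function.Injective col := fun e e' h =>
    Subtype.ext (by rw [← hcol e, ← hcol e', h])
  -- Connectedness needs at least as many edges as there are colours, and no more are available. So
  -- each colour gives its own edge, and `T` is a tree.
  have hle : Nat.card T.edgeSet ≤ Nat.card F := Nat.card_le_card_of_injective col col_inj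
  have hge := hTconn.card_vert_le_card_edgeSet_add_one
  have hcardT : Nat.card T.edgeSet = Nat.card F := by omega
  have col_bij : Function.Bijective col :=
    (Nat.bijective_iff_injective_and_card col).2 ⟨col_inj, hcardT⟩
  have hωclass (u : F) : InClass (ω u) 2 1 := ⟨by rw [(hωn u).sign, word_sign u.2.2.1],
    by rw [hωl u]⟩
  have hωinj (u v : F) (huv : Neck (ω u) (ω v)) : u = v :=
    Subtype.ext (word_inj u.2.1 v.2.1 (((hωn u).trans huv).trans (hωn v).symm))
  refine ⟨T, fun e => ⟨necklace (ω (col e)), _, hωclass _, rfl⟩, fun e => ω (col e), word 1,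
    ⟨?_, ?_, ?_⟩, ⟨word_sign Perm.sign_one, by rw [word_last (one_mem _)]⟩,
    fun e => ⟨hωclass _, rfl⟩, ?_, ?_, ?_, ?_⟩
  · rw [SimpleGraph.isTree_iff_connected_and_card]
    exact ⟨hTconn, by rw [hcardT, hcardC]⟩
  · intro c d hcd
    set u := col ⟨s(c, d), hcd⟩ with hu
    have hxu := hx u.1 u.2.1 u.2.2.1 u.2.2.2
    have hadj : ε u = s(c, d) := hcol ⟨s(c, d), hcd⟩
    have key (c d : Chain n) (hne : c ≠ d) (hc : ch (fst u) = c) (hd : ch (snd u) = d) :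
        Connects (x u.1 + 4) ⟨necklace (ω u), _, hωclass _, rfl⟩ c d := by
      have l1 := lastThree_mul_lastRot hn (hωl u)
      refine ⟨by omega, by omega, hne, ω u, ω u * lastRot n, ω u * lastRot n * lastRot n, ?_,
        hωl u, l1, lastThree_mul_lastRot hn l1, rfl, hc ▸ (hfst u).2, hd ▸ (hsnd u).2⟩
      intro p hp
      have hr : lastRot n p = p := by
        refine cyc_apply_of_ne ?_ ?_ ?_ <;> rintro rfl <;> simp only [posA, posB, posC] at hp <;>
          omega
      simp only [Perm.mul_apply, hr, and_self]
    refine ⟨x u.1 + 4, ?_⟩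
    rcases Sym2.eq_iff.1 hadj with ⟨h1, h2⟩ | ⟨h1, h2⟩
    · exact Or.inl (key c d hcd.ne h1 h2)
    · exact Or.inr (key d c hcd.ne.symm h1 h2)
  · intro e e' hee
    have h1 : necklace (ω (col e)) = necklace (ω (col e')) := congrArg Subtype.val hee
    have h2 : ω (col e') ∈ necklace (ω (col e')) := by
      rw [necklace, Cycle.mem_coe_iff, mem_necklaceList hn]; exact Neck.refl _
    rw [← h1, necklace, Cycle.mem_coe_iff, mem_necklaceList hn] at h2
    exact col_inj (hωinj _ _ h2)
  · exact fun e => ⟨_, _, (hcol e).symm, (hfst _).2, (hsnd _).2⟩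
  · exact fun e e' hee => col_inj (hωinj _ _ hee)
  · intro e he
    have := word_inj (one_mem _) (col e).2.1 (he.trans (hωn (col e)).symm)
    exact (col e).2.2.2 this.symm
  · intro q hq
    obtain ⟨u, hu, hun⟩ := word_surj hq
    by_cases h1 : u = 1
    · exact Or.inl (h1 ▸ hun)
    · obtain ⟨e, he⟩ := col_bij.2 ⟨u, hu.1, hu.2, h1⟩
      refine Or.inr ⟨e, ?_⟩
      have := (hωn (col e)).symm
      rw [he] at this
      change Neck (ω (col e)) q
      rw [he]
      exact this.trans hun

end RankModulation

namespace RankModulation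

open Equiv

variable {n : ℕ}

/-! ### Merging cycles -/

theorem rel_of_sameCycle {X : Type*} {f : Perm X} {R : X → X → Prop} (refl : ∀ a, R a a)
    (symm : ∀ {a b}, R a b → R b a) (trans : ∀ {a b c}, R a b → R b c → R a c)
    (h : ∀ a, R (f a) a) {a b : X} (hab : f.SameCycle a b) : R a b := by
  obtain ⟨k, rfl⟩ := hab
  induction k with
  | zero => simpa using refl a
  | succ k ih =>
    refine trans ih (symm ?_)
    rw [add_comm, zpow_add, Perm.mul_apply, zpow_one]
    exact h _
  | pred k ih =>
    refine trans ih ?_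
    have := h ((f ^ (-(k : ℤ) - 1)) a)
    rwa [← Perm.mul_apply, ← zpow_one_add, add_sub_cancel] at this

theorem mem_of_sameCycle {X : Type*} [Finite X] {f : Perm X} {Y : Set X}
    (h : ∀ a ∈ Y, f a ∈ Y) {a b : X} (ha : a ∈ Y) (hab : f.SameCycle a b) : b ∈ Y := by
  obtain ⟨k, -, rfl⟩ := hab.exists_pow_eq'
  clear hab
  induction k with
  | zero => exact ha
  | succ k ih => rw [pow_succ', Perm.mul_apply]; exact h _ ih

/-- If every cycle of `f` contains at most one element of `S` then replacing `f` by `f ∘ c` on `S`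
merges the cycles of `s` and `c s` for all `s` in `S`. -/
theorem sameCycle_merge {X : Type*} [Finite X] {f f' : Perm X} {S : Set X} {c : X → X}
    (hc : ∀ s ∈ S, c s ∈ S) (h0 : ∀ p, p ∉ S → f' p = f p) (h1 : ∀ s ∈ S, f' s = f (c s))
    (h : ∀ s ∈ S, ∀ t ∈ S, f.SameCycle s t → s = t) :
    (∀ p, f'.SameCycle (f p) p) ∧ ∀ s ∈ S, f'.SameCycle s (c s) := by
  -- From `f s` on, `f'` follows `f` until the first return to `s`, since no other element of `S`
  -- lies on this cycle.
  have key : ∀ s ∈ S, f'.SameCycle (f s) s := by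
    intro s hs
    have hex : ∃ k, 0 < k ∧ (f ^ k) s = s :=
      ⟨orderOf f, orderOf_pos f, by rw [pow_orderOf_eq_one, Perm.one_apply]⟩
    classical
    obtain ⟨hk0, hk⟩ := Nat.find_spec hex
    have hmin : ∀ i, 0 < i → i < Nat.find hex → (f ^ i) s ∉ S := by
      intro i hi hik hiS
      have := h s hs _ hiS ⟨i, by simp⟩
      exact Nat.find_min hex hik ⟨hi, this.symm⟩
    have hpow : ∀ i, i + 1 ≤ Nat.find hex → (f' ^ i) (f s) = (f ^ (i + 1)) s := by
      intro i
      induction i with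
      | zero => simp
      | succ i ih =>
        intro hi
        rw [pow_succ', Perm.mul_apply, ih (by omega), h0 _ (hmin _ (by omega) (by omega)),
          pow_succ' f (i + 1), Perm.mul_apply]
    refine ⟨(Nat.find hex - 1 : ℕ), ?_⟩
    rw [zpow_natCast, hpow _ (by omega), Nat.sub_add_cancel hk0, hk]
  refine ⟨fun p => ?_, fun s hs => ?_⟩
  · by_cases hp : p ∈ S
    · exact key p hp
    · rw [← h0 p hp]
      exact Perm.sameCycle_apply_left.2 (Perm.SameCycle.refl _ _)
  · have := key _ (hc s hs)
    rw [← h1 s hs] at this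
    exact Perm.sameCycle_apply_left.1 this

/-- `f` is `t_{2n+1}` on `S` and `t_{2n-1}` elsewhere, and its cycles are made of the necklaces that
are joined by `S`. -/
structure IsMerged (S : Set (OddPerm n)) (f : OddPerm n ≃ OddPerm n) : Prop where
  of_mem : ∀ p ∈ S, f p = tLow (p * lastRot n)
  of_notMem : ∀ p, p ∉ S → f p = tLow p
  low : ∀ p, Perm.SameCycle f (tLow p) p
  rot : ∀ p ∈ S, Perm.SameCycle f p (p * lastRot n)

theorem tLow_injective : Function.Injective (tLow : OddPerm n → OddPerm n) :=
  fun _ _ h => mul_right_cancel h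

theorem exists_isMerged_empty : ∃ f, IsMerged (∅ : Set (OddPerm n)) f := by
  refine ⟨Equiv.ofBijective _ (Finite.injective_iff_bijective.1 tLow_injective),
    by simp, fun p _ => rfl, fun p => ?_, by simp⟩
  exact Perm.sameCycle_apply_left.2 (Perm.SameCycle.refl _ _)

theorem IsMerged.neck {S : Set (OddPerm n)} {f : OddPerm n ≃ OddPerm n} (h : IsMerged S f)
    {p q : OddPerm n} (hpq : Neck p q) : Perm.SameCycle f p q := by
  have : Perm.SameCycle (Equiv.ofBijective _
      (Finite.injective_iff_bijective.1 (tLow_injective (n := n)))) p q := by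
    obtain ⟨k, rfl⟩ := hpq
    refine ⟨-k, ?_⟩
    have e : Equiv.ofBijective _ (Finite.injective_iff_bijective.1 (tLow_injective (n := n))) =
        Equiv.mulRight (lowCycle n)⁻¹ := by ext1 p; rfl
    rw [e, Equiv.zpow_mulRight]
    simp
  exact rel_of_sameCycle (R := fun a b => Perm.SameCycle f a b) (Perm.SameCycle.refl _)
    Perm.SameCycle.symm Perm.SameCycle.trans h.low this

theorem IsMerged.union (hn : 3 ≤ n) {S S' : Set (OddPerm n)} {f : OddPerm n ≃ OddPerm n}
    (h : IsMerged S f) (hS : ∀ p ∈ S, p * lastRot n ∈ S) (hS' : ∀ p ∈ S', p * lastRot n ∈ S')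
    (hdis : ∀ p ∈ S, p ∉ S') (hone : ∀ s ∈ S', ∀ t ∈ S', Perm.SameCycle f s t → s = t) :
    ∃ f', IsMerged (S ∪ S') f' := by
  classical
  have back {S : Set (OddPerm n)} (hS : ∀ p ∈ S, p * lastRot n ∈ S) {p : OddPerm n}
      (hp : p * lastRot n ∈ S) : p ∈ S := by
    have := hS _ (hS _ hp)
    rwa [mul_lastRot_three hn] at this
  have hU : ∀ p ∈ S ∪ S', p * lastRot n ∈ S ∪ S' := fun p hp => hp.imp (hS p) (hS' p)
  let g : OddPerm n → OddPerm n := fun p =>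
    if p ∈ S ∪ S' then tLow (p * lastRot n) else tLow p
  have gmem {p : OddPerm n} (hp : p ∈ S ∪ S') : g p = tLow (p * lastRot n) := if_pos hp
  have gnot {p : OddPerm n} (hp : p ∉ S ∪ S') : g p = tLow p := if_neg hp
  -- `S ∪ S'` is closed under rotation, so the two branches of `g` have disjoint images.
  have ginj : Function.Injective g := by
    intro p q hpq
    by_cases hp : p ∈ S ∪ S' <;> by_cases hq : q ∈ S ∪ S'
    · rw [gmem hp, gmem hq] at hpq
      exact mul_right_cancel (tLow_injective hpq)
    · rw [gmem hp, gnot hq] at hpq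
      exact absurd (tLow_injective hpq ▸ hU p hp) hq
    · rw [gnot hp, gmem hq] at hpq
      exact absurd ((tLow_injective hpq).symm ▸ hU q hq) hp
    · rw [gnot hp, gnot hq] at hpq
      exact tLow_injective hpq
  let f' : OddPerm n ≃ OddPerm n :=
    Equiv.ofBijective g (Finite.injective_iff_bijective.1 ginj)
  have hf' (p : OddPerm n) : f' p = g p := rfl
  obtain ⟨m1, m2⟩ := sameCycle_merge (f := f) (f' := f') hS'
    (by
      intro p hp
      by_cases hpS : p ∈ S
      · rw [hf', gmem (Or.inl hpS), h.of_mem p hpS]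
      · rw [hf', gnot (by rintro (h | h) <;> contradiction), h.of_notMem p hpS])
    (by
      intro s hs
      rw [hf', gmem (Or.inr hs), h.of_notMem _ fun hsS => hdis _ hsS (hS' s hs)])
    hone
  have mono {a b : OddPerm n} (hab : Perm.SameCycle f a b) : Perm.SameCycle f' a b :=
    rel_of_sameCycle (R := fun a b => Perm.SameCycle f' a b) (Perm.SameCycle.refl _)
      Perm.SameCycle.symm Perm.SameCycle.trans m1 hab
  exact ⟨f', fun p hp => gmem hp, fun p hp => gnot hp, fun p => mono (h.low p),
    fun p hp => hp.elim (fun hp => mono (h.rot p hp)) (m2 p)⟩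

/-! ### Merging the necklaces of every chain -/

/-- All triples of permutations that belong to one edge are merged at once. This is allowed because
inside `V` a cycle of `f` keeps the necklace of the root, while outside `V` the cycles are still
single necklaces. Either way a cycle contains at most one permutation matching the edge. -/
theorem Grow.exists_isMerged (hn : 3 ≤ n) {Φ : ℕ × ℕ → OddPerm n} {V W : Set (ℕ × ℕ)}
    {E : List (ℕ × ℕ × ℕ)} (h : Grow (2 * n + 1) V E W) : ∀ (S : Set (OddPerm n))
    (f : OddPerm n ≃ OddPerm n), CompatibleWith n Φ E → IsMerged S f →
    (∀ p ∈ S, p * lastRot n ∈ S) →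
    (∀ p ∈ S, (lastThree p).2 ∈ V ∧ root Φ (p * lastRot n) = root Φ p) →
    ∃ f', IsMerged (S ∪ {p | ∃ e ∈ E, Matches e (lastThree p)}) f' := by
  induction h with
  | nil V =>
    intro S f _ hf _ _
    refine ⟨f, ?_⟩
    convert hf
    simp
  | @cons V W e E x y z he hV hyz hzx hne hlow hup _ ih =>
    intro S f hE hf hS hSV
    have hr {p : OddPerm n} (hp : Matches e (lastThree p)) :=
      hE.root_mul_lastRot hn List.mem_cons_self hp
    have hS' : ∀ p ∈ {p : OddPerm n | Matches e (lastThree p)},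
        p * lastRot n ∈ {p : OddPerm n | Matches e (lastThree p)} :=
      fun p hp => Matches.mul_lastRot hn hp
    have hlast {p : OddPerm n} (hp : Matches e (lastThree p)) : lastThree p = (x, y, z) ∨
        lastThree p = (y, z, x) ∨ lastThree p = (z, x, y) := by
      obtain ⟨⟨a, b, c⟩, hl⟩ : ∃ t, lastThree p = t := ⟨_, rfl⟩
      rw [hl] at hp ⊢
      simpa only [Prod.mk.injEq] using he.eq_or hp
    have hdis : ∀ p ∈ S, p ∉ {p : OddPerm n | Matches e (lastThree p)} := by
      intro p hpS hp
      have c0 := (hSV _ hpS).1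
      have c1 := (hSV _ (hS _ hpS)).1
      rcases hlast hp with hl | hl | hl
      · rw [hl] at c0; exact hyz c0
      · rw [hl] at c0; exact hzx c0
      · rw [lastThree_mul_lastRot hn hl] at c1; exact hzx c1
    have hone : ∀ s ∈ {p : OddPerm n | Matches e (lastThree p)},
        ∀ t ∈ {p : OddPerm n | Matches e (lastThree p)}, Perm.SameCycle f s t → s = t := by
      intro s hs t ht hst
      have hR := rel_of_sameCycle (f := f) (R := fun a b =>
        ((lastThree a).2 ∈ V ∧ (lastThree b).2 ∈ V ∧ Neck (root Φ a) (root Φ b)) ∨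
        ((lastThree a).2 ∉ V ∧ (lastThree b).2 ∉ V ∧ Neck a b))
        (fun a => by
          by_cases ha : (lastThree a).2 ∈ V
          · exact Or.inl ⟨ha, ha, Neck.refl _⟩
          · exact Or.inr ⟨ha, ha, Neck.refl _⟩)
        (by
          rintro a b (⟨h1, h2, h3⟩ | ⟨h1, h2, h3⟩)
          · exact Or.inl ⟨h2, h1, h3.symm⟩
          · exact Or.inr ⟨h2, h1, h3.symm⟩)
        (by
          rintro a b c (⟨h1, h2, h3⟩ | ⟨h1, h2, h3⟩) (⟨h4, h5, h6⟩ | ⟨h4, h5, h6⟩)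
          · exact Or.inl ⟨h1, h5, h3.trans h6⟩
          · exact absurd h2 h4
          · exact absurd h4 h2
          · exact Or.inr ⟨h1, h5, h3.trans h6⟩)
        (by
          intro a
          by_cases ha : a ∈ S
          · rw [hf.of_mem a ha]
            left
            have h1 := (neck_tLow (a * lastRot n)).symm
            refine ⟨?_, (hSV a ha).1, ?_⟩
            · rw [← h1.lastThree_snd hn]; exact (hSV _ (hS a ha)).1
            · rw [← (hSV a ha).2]; exact h1.root hn Φ
          · rw [hf.of_notMem a ha]
            have h1 := (neck_tLow a).symm
            by_cases haV : (lastThree a).2 ∈ V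
            · exact Or.inl ⟨h1.lastThree_snd hn ▸ haV, haV, h1.root hn Φ⟩
            · exact Or.inr ⟨h1.lastThree_snd hn ▸ haV, haV, h1⟩)
        hst
      have e3 : (lastThree s).2 = (lastThree t).2 → lastThree s = lastThree t := by
        intro e2
        rcases hlast hs with hl | hl | hl <;> rcases hlast ht with hl' | hl' | hl' <;>
          rw [hl, hl'] at e2 ⊢ <;> simp only [Prod.mk.injEq] at e2 ⊢ <;> omega
      rcases hR with ⟨h1, h2, h3⟩ | ⟨-, -, h3⟩
      · have hcls {p : OddPerm n} (hp : Matches e (lastThree p)) (hpV : (lastThree p).2 ∈ V) :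
            (lastThree p).2 = (x, y) := by
          rcases hlast hp with hl | hl | hl <;> rw [hl] at hpV ⊢
          · exact absurd hpV hyz
          · exact absurd hpV hzx
        have e1 := hcls hs h1
        have e2 := hcls ht h2
        have h4 : Neck s t := by
          have := h3.mul_left (Φ (x, y))⁻¹
          simpa only [root, e1, e2, inv_mul_cancel_left] using this
        exact (h4.eq_of_lastThree hn (e3 (e1.trans e2.symm)).symm).symm
      · exact (h3.eq_of_lastThree hn (e3 (h3.lastThree_snd hn).symm).symm).symm
    obtain ⟨f₁, hf₁⟩ := hf.union hn hS hS' hdis hone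
    obtain ⟨f₂, hf₂⟩ := ih _ f₁ (fun e' he' => hE e' (List.mem_cons_of_mem _ he')) hf₁
      (fun p hp => hp.imp (hS p) (hS' p)) (by
        rintro p (hp | hp)
        · exact ⟨Or.inl (hSV p hp).1, (hSV p hp).2⟩
        · refine ⟨?_, hr hp⟩
          rcases hlast hp with hl | hl | hl <;> rw [hl]
          · exact Or.inr (Or.inl rfl)
          · exact Or.inr (Or.inr rfl)
          · exact Or.inl hV)
    refine ⟨f₂, ?_⟩
    convert hf₂ using 1
    ext p
    simp only [List.mem_cons, exists_eq_or_imp, Set.mem_union, Set.mem_ofPred_eq, or_assoc]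

/-- The permutations after which two necklaces are inserted into a chain, and the last ones of
these necklaces. -/
def treeRots (n : ℕ) : Set (OddPerm n) :=
  {p | ∃ e ∈ nearlySpanningTree n, Matches e (lastThree p)}

theorem mul_lastRot_mem_treeRots (hn : 3 ≤ n) {p : OddPerm n} (hp : p ∈ treeRots n) :
    p * lastRot n ∈ treeRots n := by
  obtain ⟨e, he, hm⟩ := hp
  exact ⟨e, he, hm.mul_lastRot hn⟩

theorem exists_isMerged_treeRots (hn : 3 ≤ n) :
    ∃ f, IsMerged (treeRots n) f := by
  obtain ⟨Φ, hΦ⟩ := exists_isRelabelling hn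
  obtain ⟨f, hf⟩ := exists_isMerged_empty (n := n)
  obtain ⟨f', hf'⟩ := (grow_nearlySpanningTree (n := n) (by omega) le_rfl).exists_isMerged hn
    (Φ := Φ) ∅ f hΦ.compatible hf (by simp) (by simp)
  exact ⟨f', by rwa [Set.empty_union] at hf'⟩

theorem Grow.mem_of_matches {V W : Set (ℕ × ℕ)} {E : List (ℕ × ℕ × ℕ)} {N : ℕ}
    (h : Grow N V E W) : V ⊆ W ∧ ∀ e ∈ E, ∀ x y z, Matches e (x, y, z) → (x, y) ∈ W := by
  induction h with
  | nil V => simp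
  | cons x y z he hV hyz hzx hne hlow hup _ ih =>
    refine ⟨Set.subset_union_left.trans ih.1, ?_⟩
    intro e' he' x' y' z' hm
    rcases List.mem_cons.1 he' with rfl | he'
    · apply ih.1
      rcases he.eq_or hm with ⟨rfl, rfl, rfl⟩ | ⟨rfl, rfl, rfl⟩ | ⟨rfl, rfl, rfl⟩
      · exact Or.inl hV
      · exact Or.inr (Or.inl rfl)
      · exact Or.inr (Or.inr rfl)
    · exact ih.2 e' he' x' y' z' hm

theorem lastThree_mem_visited (hn : 3 ≤ n) {p : OddPerm n} (hp : p ∈ treeRots n) :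
    (lastThree p).2 ∈ visited n := by
  obtain ⟨e, he, hm⟩ := hp
  exact (grow_nearlySpanningTree (n := n) (by omega) le_rfl).mem_of_matches.2 e he _ _ _ hm.rotate

/-- `S` may be larger than the set of tree rotations, so this still applies after linkages have been
merged in. -/
theorem Grow.sameCycle_root (hn : 3 ≤ n) {Φ : ℕ × ℕ → OddPerm n} {f : OddPerm n ≃ OddPerm n}
    {S : Set (OddPerm n)} (hf : IsMerged S f) {V W : Set (ℕ × ℕ)} {E : List (ℕ × ℕ × ℕ)}
    (h : Grow (2 * n + 1) V E W) : CompatibleWith n Φ E →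
    (∀ e ∈ E, ∀ p, Matches e (lastThree p) → p ∈ S) →
    (∀ p, (lastThree p).2 ∈ V → Perm.SameCycle f p (root Φ p)) →
    ∀ p, (lastThree p).2 ∈ W → Perm.SameCycle f p (root Φ p) := by
  induction h with
  | nil V => exact fun _ _ h => h
  | @cons V W e E x y z he hV hyz hzx hne hlow hup _ ih =>
    intro hE hES hVr
    refine ih (fun e' he' => hE e' (List.mem_cons_of_mem _ he'))
      (fun e' he' => hES e' (List.mem_cons_of_mem _ he')) ?_
    have hr {p : OddPerm n} (hp : Matches e (lastThree p)) :=
      hE.root_mul_lastRot hn List.mem_cons_self hp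
    have hrot {p : OddPerm n} (hp : Matches e (lastThree p)) :=
      hf.rot p (hES e List.mem_cons_self p hp)
    rintro q (hq | hq | hq)
    · exact hVr q hq
    · obtain ⟨p, hp, hl⟩ := exists_neck_lastThree hn q hq hlow.1 hup.1 hne.1 hne.2.2
      have hl1 := lastThree_mul_lastRot hn hl
      have hm : Matches e (lastThree p) := by rw [hl]; exact he
      have h1 := hVr (p * lastRot n) (by rw [hl1]; exact hV)
      rw [hr hm] at h1
      exact (((hf.neck hp).trans (hrot hm)).trans h1).trans (hf.neck (hp.root hn Φ)).symm
    · obtain ⟨p, hp, hl⟩ := exists_neck_lastThree hn q hq hlow.2.1 hup.2.1 hne.2.1 hne.1.symm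
      have hl1 := lastThree_mul_lastRot hn hl
      have hl2 := lastThree_mul_lastRot hn hl1
      have hm : Matches e (lastThree p) := by rw [hl]; exact he.rotate
      have hm1 := hm.mul_lastRot hn
      have h1 := hVr (p * lastRot n * lastRot n) (by rw [hl2]; exact hV)
      rw [hr hm1, hr hm] at h1
      exact ((((hf.neck hp).trans (hrot hm)).trans (hrot hm1)).trans h1).trans
        (hf.neck (hp.root hn Φ)).symm

end RankModulation

namespace RankModulation

open Equiv

variable {n : ℕ}

/-! ### Membership in chains -/

theorem Chain.lastThree_mem_visited (hn : 3 ≤ n) (C : Chain n) {p : OddPerm n} (hp : p ∈ C.1) :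
    (lastThree p).2 ∈ visited n := by
  obtain ⟨Φ, hΦ⟩ := exists_isRelabelling hn
  obtain ⟨_, π, hπ, rfl⟩ := C
  exact ((mem_chainOf hn hΦ hπ.2).1 hp).1

theorem Chain.mem_of_neck (hn : 3 ≤ n) (C : Chain n) {p q : OddPerm n} (hp : p ∈ C.1)
    (hpq : Neck p q) : q ∈ C.1 := by
  obtain ⟨Φ, hΦ⟩ := exists_isRelabelling hn
  obtain ⟨_, π, hπ, rfl⟩ := C
  have := (mem_chainOf hn hΦ hπ.2).1 hp
  exact (mem_chainOf hn hΦ hπ.2).2 ⟨by rw [hpq.lastThree_snd hn]; exact this.1,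
    this.2.trans (hpq.root hn Φ)⟩

theorem Chain.mul_lastRot_mem (hn : 3 ≤ n) (C : Chain n) {p : OddPerm n} (hp : p ∈ C.1)
    (hpS : p ∈ treeRots n) : p * lastRot n ∈ C.1 := by
  obtain ⟨Φ, hΦ⟩ := exists_isRelabelling hn
  obtain ⟨_, π, hπ, rfl⟩ := C
  refine (mem_chainOf hn hΦ hπ.2).2
    ⟨RankModulation.lastThree_mem_visited hn (mul_lastRot_mem_treeRots hn hpS), ?_⟩
  obtain ⟨e, he, hm⟩ := hpS
  rw [hΦ.compatible.root_mul_lastRot hn he hm]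
  exact ((mem_chainOf hn hΦ hπ.2).1 hp).2

theorem Chain.eq_of_mem (hn : 3 ≤ n) {C D : Chain n} {p : OddPerm n} (hC : p ∈ C.1)
    (hD : p ∈ D.1) : C = D := by
  obtain ⟨Φ, hΦ⟩ := exists_isRelabelling hn
  obtain ⟨_, π, hπ, rfl⟩ := C
  obtain ⟨_, σ, hσ, rfl⟩ := D
  have h1 := ((mem_chainOf hn hΦ hπ.2).1 hC).2
  have h2 := ((mem_chainOf hn hΦ hσ.2).1 hD).2
  exact Subtype.ext (chainOf_eq_of_neck hn (h1.trans h2.symm))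

theorem root_inClass {Φ : ℕ × ℕ → OddPerm n} (hΦ : IsRelabelling n Φ) (hn : 3 ≤ n)
    {p : OddPerm n} (hp : (lastThree p).2 ∈ visited n) :
    (lastThree (root Φ p)).2 = (1, 2) ∧ Perm.sign (root Φ p) = Perm.sign p := by
  obtain ⟨h1, h2, h3⟩ := hΦ.relabels _ hp
  constructor
  · simp only [lastThree_eq, lab_val_add_one] at h1 h2
    simp only [lastThree_eq, root, Perm.mul_apply, h1, h2,
      val_lab (n := n) (l := 1) le_rfl (by omega),
      val_lab (n := n) (l := 2) (by omega) (by omega)]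
  · rw [root, Perm.sign_mul, h3, one_mul]

theorem Chain.sign_eq_one (hn : 3 ≤ n) (C : Chain n) {p : OddPerm n} (hp : p ∈ C.1) :
    Perm.sign p = 1 := by
  obtain ⟨Φ, hΦ⟩ := exists_isRelabelling hn
  obtain ⟨_, π, hπ, rfl⟩ := C
  obtain ⟨h1, h2⟩ := (mem_chainOf hn hΦ hπ.2).1 hp
  rw [← (root_inClass hΦ hn h1).2, h2.sign, hπ.1]

theorem exists_chain_mem (hn : 3 ≤ n) {p : OddPerm n} (hs : Perm.sign p = 1)
    (hp : (lastThree p).2 ∈ visited n) : ∃ C : Chain n, p ∈ C.1 := by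
  obtain ⟨Φ, hΦ⟩ := exists_isRelabelling hn
  obtain ⟨h1, h2⟩ := root_inClass hΦ hn hp
  exact ⟨⟨chainOf (root Φ p), _, ⟨by rw [h2, hs], h1⟩, rfl⟩,
    (mem_chainOf hn hΦ h1).2 ⟨hp, Neck.refl _⟩⟩

theorem Chain.sameCycle (hn : 3 ≤ n) (C : Chain n) {S : Set (OddPerm n)}
    {f : OddPerm n ≃ OddPerm n} (hf : IsMerged S f) (hS : treeRots n ⊆ S) {p q : OddPerm n}
    (hp : p ∈ C.1) (hq : q ∈ C.1) : Perm.SameCycle f p q := by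
  obtain ⟨Φ, hΦ⟩ := exists_isRelabelling hn
  obtain ⟨_, π, hπ, rfl⟩ := C
  have key := (grow_nearlySpanningTree (n := n) (by omega) le_rfl).sameCycle_root hn (Φ := Φ) hf
    hΦ.compatible (fun e he p hp => hS ⟨e, he, hp⟩) (by
      intro p hp
      rw [Set.mem_singleton_iff] at hp
      rw [root, hp, hΦ.one, one_mul])
  obtain ⟨h1, h2⟩ := (mem_chainOf hn hΦ hπ.2).1 hp
  obtain ⟨h3, h4⟩ := (mem_chainOf hn hΦ hπ.2).1 hq
  exact ((key p h1).trans (hf.neck (h2.symm.trans h4))).trans (key q h3).symm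

/-! ### Merging the chains along the spanning tree -/

/-- The permutations at which the chains are merged through the linkages of `ω e`, `e ∈ F`. -/
def linkRots {ι : Type*} (ω : ι → OddPerm n) (F : Set ι) : Set (OddPerm n) :=
  {p | ∃ e ∈ F, p = ω e ∨ p = ω e * lastRot n ∨ p = ω e * lastRot n * lastRot n}

theorem mul_lastRot_mem_linkRots (hn : 3 ≤ n) {ι : Type*} {ω : ι → OddPerm n} {F : Set ι}
    {p : OddPerm n} (hp : p ∈ linkRots ω F) : p * lastRot n ∈ linkRots ω F := by
  obtain ⟨e, he, rfl | rfl | rfl⟩ := hp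
  · exact ⟨e, he, Or.inr (Or.inl rfl)⟩
  · exact ⟨e, he, Or.inr (Or.inr rfl)⟩
  · refine ⟨e, he, Or.inl ?_⟩
    rw [mul_lastRot_three hn]

theorem two_one_notMem_visited : ((2, 1) : ℕ × ℕ) ∉ visited n := by
  simp [visited]

/-- The linkages `ω e` of the edges `e` of the tree `T`. -/
structure LinksTree (T : SimpleGraph (Chain n)) (ω : T.edgeSet → OddPerm n) : Prop where
  isTree : T.IsTree
  inClass : ∀ e, InClass (ω e) 2 1
  joins : ∀ e, ∃ C D : Chain n, e.1 = s(C, D) ∧ ω e * lastRot n ∈ C.1 ∧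
    ω e * lastRot n * lastRot n ∈ D.1
  injective : ∀ e e', Neck (ω e) (ω e') → e = e'

theorem LinksTree.eq_of_mem_linkRots (hn : 3 ≤ n) {T : SimpleGraph (Chain n)}
    {ω : T.edgeSet → OddPerm n} (h : LinksTree T ω) {F : Set T.edgeSet} {p : OddPerm n}
    (hp : p ∈ linkRots ω F) (hc : (lastThree p).2 = (2, 1)) : ∃ e ∈ F, p = ω e := by
  obtain ⟨e, he, rfl | rfl | rfl⟩ := hp
  · exact ⟨e, he, rfl⟩
  · obtain ⟨C, D, -, hC, -⟩ := h.joins e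
    exact absurd (hc ▸ C.lastThree_mem_visited hn hC) two_one_notMem_visited
  · obtain ⟨C, D, -, -, hD⟩ := h.joins e
    exact absurd (hc ▸ D.lastThree_mem_visited hn hD) two_one_notMem_visited

theorem LinksTree.eq_of_mem (hn : 3 ≤ n) {T : SimpleGraph (Chain n)}
    {ω : T.edgeSet → OddPerm n} (h : LinksTree T ω) {F : Set T.edgeSet} {p : OddPerm n}
    (hp : p ∈ treeRots n ∪ linkRots ω F) (hc : (lastThree p).2 = (2, 1)) : ∃ e ∈ F, p = ω e := by
  rcases hp with hp | hp
  · exact absurd (hc ▸ lastThree_mem_visited hn hp) two_one_notMem_visited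
  · exact h.eq_of_mem_linkRots hn hp hc

theorem LinksTree.exists_isMerged_insert (hn : 3 ≤ n) {T : SimpleGraph (Chain n)}
    {ω : T.edgeSet → OddPerm n} (h : LinksTree T ω) {F : Set T.edgeSet}
    {f : OddPerm n ≃ OddPerm n} (hf : IsMerged (treeRots n ∪ linkRots ω F) f) {e : T.edgeSet}
    (he : e ∉ F) : ∃ f', IsMerged (treeRots n ∪ linkRots ω F ∪ linkRots ω {e}) f' := by
  set S := treeRots n ∪ linkRots ω F with hS
  obtain ⟨C₁, D₁, heq, hC₁, hD₁⟩ := h.joins e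
  have hcls := (h.inClass e).2
  have hmulS : ∀ p ∈ S, p * lastRot n ∈ S := fun p hp =>
    hp.imp (mul_lastRot_mem_treeRots hn) (mul_lastRot_mem_linkRots hn)
  have hωS : ∀ p, Neck (ω e) p → p ∉ S := by
    intro p hp hpS
    obtain ⟨e', he', rfl⟩ := h.eq_of_mem hn hpS (by rw [hp.lastThree_snd hn, hcls])
    exact he (h.injective _ _ hp ▸ he')
  have r3 := mul_lastRot_three hn (ω e)
  -- the necklace of `ω e` is a cycle of `f`
  have hneck {q : OddPerm n} (hq : Perm.SameCycle f (ω e) q) : (lastThree q).2 = (2, 1) := by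
    have : q ∈ {p | Neck (ω e) p} := by
      refine mem_of_sameCycle (f := f) ?_ (Neck.refl (ω e) : ω e ∈ {p | Neck (ω e) p}) hq
      intro a ha
      rw [hf.of_notMem a (hωS a ha)]
      exact Neck.trans ha (neck_tLow a)
    rw [Neck.lastThree_snd hn this, hcls]
  -- the chains of the edge are not yet merged
  have hsep : ¬ Perm.SameCycle f (ω e * lastRot n) (ω e * lastRot n * lastRot n) := by
    intro hsame
    set R : Chain n → Prop := fun C => (T.deleteEdges {e.1}).Reachable C₁ C with hR
    have hbridge : ¬ R D₁ := by
      have := SimpleGraph.isAcyclic_iff_forall_isBridge.1 h.isTree.isAcyclic e.2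
      rw [heq, SimpleGraph.isBridge_iff, ← heq] at this
      exact this
    have hadj (e' : T.edgeSet) (he' : e' ∈ F) {C D : Chain n} (hCD : e'.1 = s(C, D)) :
        (T.deleteEdges {e.1}).Adj C D := by
      rw [SimpleGraph.deleteEdges_adj]
      refine ⟨by rw [← SimpleGraph.mem_edgeSet, ← hCD]; exact e'.2, ?_⟩
      rw [← hCD, Set.mem_singleton_iff]
      intro e1
      exact he (Subtype.ext e1 ▸ he')
    -- The set consists of the chains on the side of `C₁` in `T` without `e`, together with the
    -- linkages of edges in `F` on that side. It is closed under `f`, so a common cycle would put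
    -- `D₁` on the side of `C₁`.
    have hmem : ω e * lastRot n * lastRot n ∈ {p : OddPerm n | (∃ C : Chain n, R C ∧ p ∈ C.1) ∨
        ∃ e' ∈ F, Neck (ω e') p ∧ ∃ C : Chain n, R C ∧ ω e' * lastRot n ∈ C.1} := by
      refine mem_of_sameCycle (f := f) ?_
        (Or.inl ⟨C₁, SimpleGraph.Reachable.refl _, hC₁⟩ : ω e * lastRot n ∈ _) hsame
      rintro p (⟨C, hRC, hpC⟩ | ⟨e', he', hp, C, hRC, hC⟩)
      · have hpv := C.lastThree_mem_visited hn hpC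
        by_cases hpS : p ∈ S
        · rw [hf.of_mem p hpS]
          rcases hpS with hpT | ⟨e', he', rfl | rfl | rfl⟩
          · exact Or.inl ⟨C, hRC, C.mem_of_neck hn (C.mul_lastRot_mem hn hpC hpT) (neck_tLow _)⟩
          · rw [(h.inClass e').2] at hpv
            exact absurd hpv two_one_notMem_visited
          · obtain ⟨C', D', hCD, hC', hD'⟩ := h.joins e'
            obtain rfl := Chain.eq_of_mem hn hpC hC'
            exact Or.inl ⟨D', hRC.trans (hadj e' he' hCD).reachable,
              D'.mem_of_neck hn hD' (neck_tLow _)⟩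
          · obtain ⟨C', D', hCD, hC', hD'⟩ := h.joins e'
            obtain rfl := Chain.eq_of_mem hn hpC hD'
            refine Or.inr ⟨e', he', ?_, C', hRC.trans (hadj e' he' hCD).symm.reachable, hC'⟩
            rw [mul_lastRot_three hn]
            exact neck_tLow _
        · rw [hf.of_notMem p hpS]
          exact Or.inl ⟨C, hRC, C.mem_of_neck hn hpC (neck_tLow _)⟩
      · have hpc : (lastThree p).2 = (2, 1) := by rw [hp.lastThree_snd hn, (h.inClass e').2]
        by_cases hpS : p ∈ S
        · rw [hf.of_mem p hpS]
          obtain ⟨e'', he'', rfl⟩ := h.eq_of_mem hn hpS hpc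
          obtain rfl := h.injective _ _ hp
          exact Or.inl ⟨C, hRC, C.mem_of_neck hn hC (neck_tLow _)⟩
        · rw [hf.of_notMem p hpS]
          exact Or.inr ⟨e', he', hp.trans (neck_tLow p), C, hRC, hC⟩
    rcases hmem with ⟨C, hRC, hC⟩ | ⟨e', he', hp, -⟩
    · exact hbridge (Chain.eq_of_mem hn hC hD₁ ▸ hRC)
    · have := D₁.lastThree_mem_visited hn hD₁
      rw [hp.lastThree_snd hn, (h.inClass e').2] at this
      exact two_one_notMem_visited this
  have hv1 := C₁.lastThree_mem_visited hn hC₁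
  have hv2 := D₁.lastThree_mem_visited hn hD₁
  have hs1 : ¬ Perm.SameCycle f (ω e) (ω e * lastRot n) := fun hs =>
    two_one_notMem_visited (hneck hs ▸ hv1)
  have hs2 : ¬ Perm.SameCycle f (ω e) (ω e * lastRot n * lastRot n) := fun hs =>
    two_one_notMem_visited (hneck hs ▸ hv2)
  refine hf.union hn hmulS (fun p hp => mul_lastRot_mem_linkRots hn hp) ?_ ?_
  · rintro p hpS ⟨e', rfl : e' = e, rfl | rfl | rfl⟩
    · exact hωS _ (Neck.refl _) hpS
    · refine hωS _ (Neck.refl _) ?_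
      rw [← r3]
      exact hmulS _ (hmulS _ hpS)
    · refine hωS _ (Neck.refl _) ?_
      rw [← r3]
      exact hmulS _ hpS
  · rintro s ⟨e', rfl : e' = e, rfl | rfl | rfl⟩ t ⟨e'', rfl : e'' = e', rfl | rfl | rfl⟩ hst
    · rfl
    · exact absurd hst hs1
    · exact absurd hst hs2
    · exact absurd hst.symm hs1
    · rfl
    · exact absurd hst hsep
    · exact absurd hst.symm hs2
    · exact absurd hst.symm hsep
    · rfl

theorem LinksTree.exists_isMerged (hn : 3 ≤ n) {T : SimpleGraph (Chain n)}
    {ω : T.edgeSet → OddPerm n} (h : LinksTree T ω) (F : Set T.edgeSet) (hF : F.Finite) :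
    ∃ f, IsMerged (treeRots n ∪ linkRots ω F) f := by
  induction F, hF using Set.Finite.induction_on with
  | empty =>
    obtain ⟨f, hf⟩ := exists_isMerged_treeRots hn
    refine ⟨f, ?_⟩
    convert hf
    ext p
    simp [linkRots]
  | @insert e F he _ ih =>
    obtain ⟨f, hf⟩ := ih
    obtain ⟨f', hf'⟩ := h.exists_isMerged_insert hn hf he
    refine ⟨f', ?_⟩
    convert hf' using 1
    rw [Set.union_assoc]
    congr 1
    ext p
    simp only [linkRots, Set.mem_union, Set.mem_ofPred_eq, Set.mem_insert_iff,
      Set.mem_singleton_iff, exists_eq_or_imp, exists_eq_left]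
    exact or_comm

/-! ### The snake -/

theorem two_le_kendallDist {N : ℕ} {σ π : Perm (Fin N)} (hne : σ ≠ π)
    (hsign : Perm.sign σ = Perm.sign π) : 2 ≤ kendallDist σ π := by
  -- Without a factorization into adjacent transpositions the infimum would be the default value 0.
  have hnon : {k | ∃ l : List (Perm (Fin N)), l.length = k ∧ (∀ s ∈ l, IsAdjacentSwap s) ∧
      σ * l.prod = π}.Nonempty := by
    have hgen : σ⁻¹ * π ∈ Submonoid.closure {s : Perm (Fin N) | IsAdjacentSwap s} := by
      rcases N with _ | N
      · rw [Subsingleton.elim (σ⁻¹ * π) 1]; exact one_mem _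
      · have h1 : σ⁻¹ * π ∈ Submonoid.closure
            (Set.range fun i : Fin N => swap i.castSucc i.succ) := by
          rw [Perm.mclosure_swap_castSucc_succ]; trivial
        refine Submonoid.closure_mono ?_ h1
        rintro _ ⟨i, rfl⟩
        exact ⟨i.castSucc, i.succ, by simp, rfl⟩
    obtain ⟨l, hl, hprod⟩ := Submonoid.exists_list_of_mem_closure hgen
    exact ⟨l.length, l, rfl, hl, by rw [hprod, mul_inv_cancel_left]⟩
  obtain ⟨l, hl, hadj, hprod⟩ := Nat.sInf_mem hnon
  rw [kendallDist, ← hl]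
  by_contra hlt
  obtain h0 | h1 : l.length = 0 ∨ l.length = 1 := by omega
  · rw [List.length_eq_zero_iff.1 h0, List.prod_nil, mul_one] at hprod
    exact hne hprod
  · obtain ⟨s, rfl⟩ := List.length_eq_one_iff.1 h1
    obtain ⟨i, j, hij, hs⟩ := hadj s (List.mem_singleton_self s)
    rw [List.prod_singleton] at hprod
    have hij' : i ≠ j := by rintro rfl; omega
    rw [← hprod, Perm.sign_mul, hs, Perm.sign_swap hij'] at hsign
    rcases Int.units_eq_one_or (Perm.sign σ) with h | h <;> rw [h] at hsign <;>
      exact absurd hsign (by decide)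

theorem exists_enumeration_of_isCycleOn {X : Type*} {f : Perm X} {U : Finset X}
    (hf : f.IsCycleOn U) (hU : U.Nonempty) {M : ℕ} (hM : U.card = M) :
    ∃ c : Fin M → X, Function.Injective c ∧ (∀ j, c (finRotate M j) = f (c j)) ∧
      Set.range c = U := by
  subst hM
  obtain ⟨a, ha⟩ := hU
  refine ⟨fun j => (f ^ j.val) a, ?_, ?_, ?_⟩
  · intro i j hij
    have := (hf.pow_apply_eq_pow_apply ha).1 hij
    exact Fin.ext (this.eq_of_lt_of_lt i.isLt j.isLt)
  · intro j
    have hstep : f ((f ^ j.val) a) = (f ^ (j.val + 1)) a := by rw [pow_succ', Perm.mul_apply]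
    simp only [hstep]
    obtain ⟨m, hm⟩ : ∃ m, U.card = m + 1 :=
      ⟨U.card - 1, by have := Finset.card_pos.2 ⟨a, ha⟩; omega⟩
    have hval : (finRotate U.card j).val = if j.val = m then 0 else j.val + 1 := by
      revert j
      rw [hm]
      intro j _
      rw [coe_finRotate]
      simp only [Fin.ext_iff, Fin.val_last]
    rw [hval]
    split_ifs with h
    · rw [h, ← hm, hf.pow_card_apply ha, pow_zero, Perm.one_apply]
    · rfl
  · ext b
    constructor
    · rintro ⟨j, rfl⟩
      exact hf.1.mapsTo.perm_pow _ ha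
    · intro hb
      obtain ⟨k, hk, rfl⟩ := hf.exists_pow_eq ha hb
      exact ⟨⟨k, hk⟩, rfl⟩

theorem card_even (hn : 3 ≤ n) : (Finset.univ.filter fun p : OddPerm n => Perm.sign p = 1).card =
    (2 * n + 1).factorial / 2 := by
  have : Nontrivial (Fin (2 * n + 1)) := Fin.nontrivial_iff_two_le.2 (by omega)
  have h := card_alternatingGroup (α := Fin (2 * n + 1))
  rw [Fintype.card_fin] at h
  rw [← h]
  exact (Fintype.card_of_subtype _ fun p => by simp [Perm.mem_alternatingGroup]).symm

theorem card_neck (hn : 3 ≤ n) (p : OddPerm n) : (necklaceList p).toFinset.card = 2 * n - 1 := by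
  rw [List.toFinset_card_of_nodup]
  · simp [necklaceList]
  · refine List.Nodup.map_on ?_ List.nodup_range
    intro i hi j hj hij
    rw [List.mem_range] at hi hj
    rw [tLow_iterate, tLow_iterate] at hij
    refine pow_injOn_Iio_orderOf ?_ ?_ (mul_left_cancel hij) <;>
      rw [orderOf_inv, orderOf_lowCycle hn] <;> assumption

theorem finite_chain : Finite (Chain n) :=
  Finite.of_surjective (fun π : {π : OddPerm n // InClass π 1 2} => (⟨chainOf π.1, _, π.2, rfl⟩ :
    Chain n)) (by rintro ⟨_, π, hπ, rfl⟩; exact ⟨⟨π, hπ⟩, rfl⟩)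

/-- Follow a walk in `T`: each edge is crossed at its rotation from `ω e * lastRot n` to `ω e *
lastRot n * lastRot n`. -/
theorem LinksTree.sameCycle_of_mem (hn : 3 ≤ n) {T : SimpleGraph (Chain n)}
    {ω : T.edgeSet → OddPerm n} (h : LinksTree T ω) {f : OddPerm n ≃ OddPerm n}
    (hf : IsMerged (treeRots n ∪ linkRots ω Set.univ) f) {C D : Chain n} {p q : OddPerm n}
    (hp : p ∈ C.1) (hq : q ∈ D.1) : Perm.SameCycle f p q := by
  obtain ⟨w⟩ := h.isTree.connected.preconnected C D
  induction w generalizing p with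
  | nil => exact Chain.sameCycle hn _ hf Set.subset_union_left hp hq
  | @cons C C' D hadj w ih =>
    obtain ⟨C₁, D₁, heq, hC₁, hD₁⟩ := h.joins ⟨s(C, C'), hadj⟩
    have hrot := hf.rot _ (Or.inr ⟨⟨s(C, C'), hadj⟩, trivial, Or.inr (Or.inl rfl)⟩)
    rcases Sym2.eq_iff.1 heq with ⟨rfl, rfl⟩ | ⟨rfl, rfl⟩
    · exact ((Chain.sameCycle hn _ hf Set.subset_union_left hp hC₁).trans hrot).trans (ih hD₁ hq)
    · exact ((Chain.sameCycle hn _ hf Set.subset_union_left hp hD₁).trans hrot.symm).trans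
        (ih hC₁ hq)

theorem mem_visited_of_ne (hn : 3 ≤ n) {p : OddPerm n} (hp : (lastThree p).2 ≠ (2, 1)) :
    (lastThree p).2 ∈ visited n := by
  have h1 := (p (posB n)).isLt
  have h2 := (p (posC n)).isLt
  have h3 : (p (posB n)).val ≠ (p (posC n)).val := fun e =>
    posB_ne_posC hn (p.injective (Fin.ext e))
  simp only [lastThree_eq, ne_eq, Prod.mk.injEq] at hp
  simp only [visited, lastThree_eq, Set.mem_ofPred_eq]
  omega

end RankModulation

open RankModulation Equiv in
theorem mainTheorem1 (n : ℕ) (hn : 3 ≤ n) :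
    ∃ (T : SimpleGraph (RankModulation.Chain n)) (label : T.edgeSet → RankModulation.Linkage n)
      (c : Fin ((2 * n + 1).factorial / 2 - 2 * n + 1) → Equiv.Perm (Fin (2 * n + 1))),
      RankModulation.IsDistinctlyLabelledSpanningTree T label ∧
      RankModulation.IsKSnake c ∧
      (∀ j, c (finRotate _ j) = RankModulation.tLow (c j) ∨
        c (finRotate _ j) = RankModulation.tTop (c j)) ∧
      Set.range c = {π | (∃ C : RankModulation.Chain n, π ∈ C.1) ∨ ∃ e, π ∈ (label e).1} := by
  obtain ⟨T, label, ω, ω₀, hT, hω₀, hlab, hjoin, hinj, hne, hcov⟩ := exists_spanningTree hn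
  have hL : LinksTree T ω := ⟨hT.isTree, fun e => (hlab e).1, hjoin, hinj⟩
  have := finite_chain (n := n)
  obtain ⟨f, hf⟩ := hL.exists_isMerged hn Set.univ (Set.toFinite _)
  set S := treeRots n ∪ linkRots ω Set.univ with hS
  have hstep (p : OddPerm n) : f p = tLow p ∨ f p = tTop p := by
    by_cases hp : p ∈ S
    · exact Or.inr (by rw [hf.of_mem p hp, tTop_eq hn])
    · exact Or.inl (hf.of_notMem p hp)
  -- The even permutations without the one unused linkage.
  let U : Finset (OddPerm n) :=
    (Finset.univ.filter fun p => Perm.sign p = 1) \ (necklaceList ω₀).toFinset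
  have mem_U {p : OddPerm n} : p ∈ U ↔ Perm.sign p = 1 ∧ ¬ Neck ω₀ p := by
    simp [U, mem_necklaceList hn]
  have hcard : U.card = (2 * n + 1).factorial / 2 - 2 * n + 1 := by
    -- This ensures that the truncated subtraction in the length agrees with removing $2n-1$
    -- elements.
    have hfac : 2 * n ≤ (2 * n + 1).factorial / 2 := by
      rw [Nat.le_div_iff_mul_le two_pos, Nat.factorial_succ]
      have h1 : 2 ≤ (2 * n).factorial := le_trans (by omega) (Nat.self_le_factorial (2 * n))
      nlinarith
    rw [Finset.card_sdiff_of_subset, card_even hn, card_neck hn]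
    · omega
    · intro p hp
      rw [List.mem_toFinset, mem_necklaceList hn] at hp
      rw [Finset.mem_filter, hp.sign, hω₀.1]
      exact ⟨Finset.mem_univ _, rfl⟩
  have mem_label {e : T.edgeSet} {p : OddPerm n} : p ∈ (label e).1 ↔ Neck (ω e) p := by
    rw [(hlab e).2, necklace, Cycle.mem_coe_iff, mem_necklaceList hn]
  have hset : (U : Set (OddPerm n)) =
      {π | (∃ C : Chain n, π ∈ C.1) ∨ ∃ e, π ∈ (label e).1} := by
    ext p
    rw [Finset.mem_coe, mem_U, Set.mem_ofPred_eq]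
    constructor
    · rintro ⟨hs, hp⟩
      by_cases hc : (lastThree p).2 = (2, 1)
      · obtain h | ⟨e, he⟩ := hcov p ⟨hs, hc⟩
        · exact absurd h hp
        · exact Or.inr ⟨e, mem_label.2 he⟩
      · exact Or.inl (exists_chain_mem hn hs (mem_visited_of_ne hn hc))
    · rintro (⟨C, hC⟩ | ⟨e, he⟩)
      · refine ⟨C.sign_eq_one hn hC, fun h => ?_⟩
        have := C.lastThree_mem_visited hn hC
        rw [h.lastThree_snd hn, hω₀.2] at this
        exact two_one_notMem_visited this
      · rw [mem_label] at he
        exact ⟨by rw [he.sign, (hlab e).1.1], fun h => hne e (h.trans he.symm)⟩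
  have hmaps : ∀ p ∈ U, f p ∈ U := by
    intro p hp
    rw [mem_U] at hp ⊢
    by_cases hpS : p ∈ S
    · rw [hf.of_mem p hpS]
      have h1 := neck_tLow (p * lastRot n)
      refine ⟨by rw [h1.sign, Perm.sign_mul, sign_lastRot hn, hp.1, mul_one], fun h => ?_⟩
      have h2 := h.trans h1.symm
      -- If `f p` were on the necklace of `ω₀`, so would be `p * lastRot n`. But the only elements
      -- of `S` in the class $[2,1]$ are the `ω e`.
      have hpS' : p * lastRot n ∈ S :=
        hpS.imp (mul_lastRot_mem_treeRots hn) (mul_lastRot_mem_linkRots hn)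
      obtain ⟨e, -, he⟩ := hL.eq_of_mem hn hpS' (by rw [h2.lastThree_snd hn, hω₀.2])
      exact hne e (he ▸ h2)
    · rw [hf.of_notMem p hpS]
      exact ⟨by rw [(neck_tLow p).sign, hp.1], fun h => hp.2 (h.trans (neck_tLow p).symm)⟩
  have hchain {p : OddPerm n} (hp : p ∈ U) : ∃ C : Chain n, ∃ q ∈ C.1, Perm.SameCycle f p q := by
    have : p ∈ {π | (∃ C : Chain n, π ∈ C.1) ∨ ∃ e, π ∈ (label e).1} := hset ▸ hp
    rcases this with ⟨C, hC⟩ | ⟨e, he⟩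
    · exact ⟨C, p, hC, Perm.SameCycle.refl _ _⟩
    · obtain ⟨C, D, -, hC, -⟩ := hjoin e
      exact ⟨C, _, hC, (hf.neck (mem_label.1 he).symm).trans
        (hf.rot _ (Or.inr ⟨e, trivial, Or.inl rfl⟩))⟩
  have hcyc : Perm.IsCycleOn f (U : Set (OddPerm n)) := by
    refine ⟨⟨hmaps, f.injective.injOn, ?_⟩, ?_⟩
    · exact Finset.surjOn_of_injOn_of_card_le f hmaps f.injective.injOn le_rfl
    · intro p hp q hq
      obtain ⟨C, p', hp', h1⟩ := hchain hp
      obtain ⟨D, q', hq', h2⟩ := hchain hq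
      exact (h1.trans (hL.sameCycle_of_mem hn hf hp' hq')).trans h2.symm
  obtain ⟨c, cinj, cstep, crange⟩ := exists_enumeration_of_isCycleOn hcyc
    (Finset.card_pos.1 (by omega)) hcard
  have cU (j) : c j ∈ U := Finset.mem_coe.1 (crange ▸ Set.mem_range_self j)
  refine ⟨T, label, c, hT, ⟨cinj, ?_, ?_⟩, ?_, crange.trans hset⟩
  · intro j
    rw [cstep]
    rcases hstep (c j) with h | h
    · exact ⟨_, by simp only [ne_eq]; omega, h⟩
    · exact ⟨_, by simp only [ne_eq]; omega, h⟩
  · intro j k hjk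
    exact two_le_kendallDist (cinj.ne hjk) ((mem_U.1 (cU j)).1.trans (mem_U.1 (cU k)).1.symm)
  · intro j
    rw [cstep]
    exact hstep _
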